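/- Let $S=[0,R]$ with $R>0$. Let $\eta:S\to[0,1]$ be a measurable regression function, $\eta(x)=\Pr(Y=+\mid X=x)$, with threshold $t\in S$: $\eta(t)=1/2$, $\eta>1/2$ on one side of $t$ and $\eta<1/2$ on the other, the side of the label $+$ being known. A query at $x\in S$ returns an independent label that is $+$ with probability $\eta(x)$. For $x\in S$ the excess risk of the threshold classifier at $x$ is $\mathcal R(x)-\mathcal R(t)=\int_{x\wedge t}^{x\vee t}|2\eta(z)-1|\,dz$. The function $\eta$ satisfies the Tsybakov noise condition (TNC) with parameters $k\ge 2$, $M>\mu>0$, $\epsilon_0>0$ if $$\mu|x-t|^{k-1}\le|\eta(x)-1/2|\le M|x-t|^{k-1}\quad\text{for all }x\in S\text{ with }|\eta(x)-1/2|\le\epsilon_0 .$$ Write $B(x,r)=[x-r,x+r]$. An optimal passive learning procedure $P$ with confidence factor $\delta\mapsto C_\delta$, where $C_\delta>\sqrt2$ for $0<\delta<1$ and $C_\delta=O(\sqrt{\log(1/\delta)})$ as $\delta\to0$, is a measurable, possibly randomized rule that, given $x\in S$, $r>0$, $N\ge1$ and $N$ labelled points drawn independently and uniformly from $S\cap B(x,r)$,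 outputs a point $P(x,r,N)\in S\cap B(x,r)$ such that, for every $\eta$ with a threshold as above (no noise condition is assumed) and every $\delta\in(0,1)$, with probability at least $1-\delta$ $$\mathcal R(P(x,r,N))-\min_{y\in S\cap B(x,r)}\mathcal R(y)\le\frac{C_\delta\, r}{\sqrt N}.$$ Algorithm 1 has input $R$, a query budget $T$, a confidence $\delta\in(0,1)$, an optimal passive learning procedure $P$ with confidence factor $C$, and any starting point $x_0\in S$; it does not know $k,\mu,M,\epsilon_0$. With $\log$ the binary logarithm, put $\tilde\delta=2\delta/\log T$, $E=\Big\lfloor\log\sqrt{2T/(C_{\tilde\delta}^2\log T)}\Big\rfloor$, $N=\lfloor T/E\rfloor$ and $R_e=2^{-e+1}R$. For $e=1,\dots,E$ it sets $x_e=P(x_{e-1},R_e,N)$, with a fresh sample in every epoch, and it outputs $x_E$. Theorem. Optimal passive learning procedures exist. For every confidence factor $C$ as above, all $k\ge2$, $M>\mu>0$, $\epsilon_0>0$ and $\delta\in(0,1)$, there are constants $K,p,T_0$, depending only on these data, on $R$ and on the orientation, such that for all $T\ge T_0$: Algorithm 1 is well defined ($E\ge1$, $N\ge1$) and uses $EN\le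 T$ queries, and for every optimal passive learning procedure $P$ with confidence factor $C$, every $\eta$ with threshold $t$ satisfying the TNC with parameters $k,\mu,M,\epsilon_0$, and every $x_0\in S$, with probability at least $1-\delta$ $$\mathcal R(x_E)-\mathcal R(t)\le K(\log T)^p\,T^{-\frac{k}{2k-2}},$$ that is, $\mathcal R(x_E)-\mathcal R(t)=\tilde O\big(T^{-k/(2k-2)}\big)$. -/

import Mathlib

open MeasureTheory Set

noncomputable section

namespace ActiveThreshold

/-- `η` is a regression function `η(x) = Pr(Y = + | X = x)` on the domain `[0, R]` with
threshold `t`: it equals `1/2` at `t` and only there, is larger than `1/2` on one side of `t` and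
smaller on the other. The orientation `s` is `1` if the side of the label `+` is the right one
and `-1` if it is the left one. -/
structure IsThreshold (s R : ℝ) (η : ℝ → ℝ) (t : ℝ) : Prop where
  measurable : Measurable η
  prob : ∀ x ∈ Icc 0 R, η x ∈ Icc (0 : ℝ) 1
  mem : t ∈ Icc 0 R
  half : η t = 1 / 2
  right : ∀ x ∈ Icc 0 R, t < x → 0 < s * (η x - 1 / 2)
  left : ∀ x ∈ Icc 0 R, x < t → s * (η x - 1 / 2) < 0

/-- The two-sided Tsybakov noise condition with exponent `k` at the threshold `t`. -/
def TNC (R : ℝ) (η : ℝ → ℝ) (t k μ M ε₀ : ℝ) : Prop :=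
  ∀ x ∈ Icc 0 R, |η x - 1 / 2| ≤ ε₀ →
    μ * |x - t| ^ (k - 1) ≤ |η x - 1 / 2| ∧ |η x - 1 / 2| ≤ M * |x - t| ^ (k - 1)

/-- The excess classification risk `𝓡(x) - 𝓡(t)` of the threshold classifier at `x` over the
Bayes classifier at `t` (uniform marginal). -/
def excessRisk (η : ℝ → ℝ) (t x : ℝ) : ℝ :=
  ∫ z in (min x t)..(max x t), |2 * η z - 1|

/-- The search region `S ∩ B(x, r)`, where `S = [0, R]` and `B(x, r) = [x - r, x + r]`. -/
def region (R x r : ℝ) : Set ℝ := Icc 0 R ∩ Icc (x - r) (x + r)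

/-- A point of `S ∩ B(x, r)`; uniformly distributed there if `u` is uniform on `[0, 1]`. -/
def query (R x r : ℝ) (u : unitInterval) : ℝ :=
  max 0 (x - r) + (u : ℝ) * (min R (x + r) - max 0 (x - r))

/-- The label of the point `q` (`true` stands for `+`); it is `+` with probability `η q` if `v` is
uniform on `[0, 1]`. -/
def label (η : ℝ → ℝ) (q : ℝ) (v : unitInterval) : Bool := decide ((v : ℝ) ≤ η q)

/-- The randomness of one call of a passive procedure with `N` queries: for every query a uniform
variable for the point and one for its label, and one for the procedure's own coin tosses.
Under `volume` all of them are independent and uniform on `[0, 1]`. -/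
abbrev Seed (N : ℕ) : Type := (Fin N → unitInterval × unitInterval) × unitInterval

/-- The labelled sample: `N` independent uniform points of `S ∩ B(x, r)` and their labels. -/
def sample (R : ℝ) (η : ℝ → ℝ) (x r : ℝ) {N : ℕ} (z : Fin N → unitInterval × unitInterval) :
    Fin N → ℝ × Bool :=
  fun i => (query R x r (z i).1, label η (query R x r (z i).1) (z i).2)

/-- A (possibly randomized) passive procedure: from a centre, a radius, the number `N` of queries,
a labelled sample of size `N` and internal randomness it computes a point. -/
abbrev PassiveProcedure : Type := ℝ → ℝ → (N : ℕ) → (Fin N → ℝ × Bool) → unitInterval → ℝ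

/-- The output of the call `P(x, r, N)` when labels are drawn according to `η`. -/
def PassiveProcedure.call (P : PassiveProcedure) (R : ℝ) (η : ℝ → ℝ) (x r : ℝ) {N : ℕ}
    (z : Seed N) : ℝ :=
  P x r N (sample R η x r z.1) z.2

/-- Admissible confidence factors `δ ↦ C_δ`: `C_δ > √2`, and `C_δ² = O(log (1/δ))` as `δ → 0`. -/
def IsConfidenceFactor (C : ℝ → ℝ) : Prop :=
  (∀ δ ∈ Ioo (0 : ℝ) 1, Real.sqrt 2 < C δ) ∧
    C =O[nhdsWithin 0 (Ioi 0)] (fun δ => Real.sqrt (Real.log (1 / δ)))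

/-- `P` is an optimal passive learning procedure on `[0, R]` (for thresholds of orientation `s`)
with confidence factor `C`: it outputs a point of `S ∩ B(x, r)` and, for every regression function
with a threshold, with probability at least `1 - δ` the risk of its output exceeds that of any
given competitor (in particular of the risk minimizer) in `S ∩ B(x, r)` by at most
`C_δ r / √N`. -/
structure IsOptimalPassive (s R : ℝ) (C : ℝ → ℝ) (P : PassiveProcedure) : Prop where
  measurable : ∀ (r : ℝ) (N : ℕ),
    Measurable (fun p : ℝ × (Fin N → ℝ × Bool) × unitInterval => P p.1 r N p.2.1 p.2.2)
  mem_region : ∀ x ∈ Icc 0 R, ∀ r > 0, ∀ (N : ℕ) (D : Fin N → ℝ × Bool) (w : unitInterval),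
    P x r N D w ∈ region R x r
  risk_le : ∀ (η : ℝ → ℝ) (t : ℝ), IsThreshold s R η t →
    ∀ x ∈ Icc 0 R, ∀ r > 0, ∀ N : ℕ, 1 ≤ N → ∀ δ ∈ Ioo (0 : ℝ) 1, ∀ y ∈ region R x r,
      ENNReal.ofReal (1 - δ) ≤
        volume {z : Seed N |
          excessRisk η t (P.call R η x r z) - excessRisk η t y ≤ C δ * r / Real.sqrt N}

/-- The confidence level `δ̃ = 2 δ / log T` of a single epoch (binary logarithm). -/
def epochConfidence (T : ℕ) (δ : ℝ) : ℝ := 2 * δ / Real.logb 2 T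

/-- The number of epochs `E = log √(2 T / (C_δ̃² log T))`, rounded down. -/
def numEpochs (C : ℝ → ℝ) (T : ℕ) (δ : ℝ) : ℕ :=
  ⌊Real.logb 2 (Real.sqrt (2 * T / (C (epochConfidence T δ) ^ 2 * Real.logb 2 T)))⌋₊

/-- The number of queries per epoch `N = T / E`, rounded down. -/
def epochQueries (C : ℝ → ℝ) (T : ℕ) (δ : ℝ) : ℕ := T / numEpochs C T δ

/-- The iterates of the adaptive learner started at `x₀`: `epochs e ω` is `x_e`, obtained by
calling `P(x_{e-1}, R_e, N)` with fresh randomness, where `R_e = 2^{-e+1} R`. -/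
def epochs (R : ℝ) (η : ℝ → ℝ) (P : PassiveProcedure) (N : ℕ) (x₀ : ℝ) :
    (e : ℕ) → (Fin e → Seed N) → ℝ
  | 0, _ => x₀
  | e + 1, ω =>
      P.call R η (epochs R η P N x₀ e (fun i => ω i.castSucc)) (R / 2 ^ e) (ω (Fin.last e))

/-- The output `x_E` of the adaptive threshold learner with oracle budget `T` and confidence
`δ`. -/
def adaptiveLearner (R : ℝ) (η : ℝ → ℝ) (C : ℝ → ℝ) (P : PassiveProcedure) (T : ℕ) (δ x₀ : ℝ)
    (ω : Fin (numEpochs C T δ) → Seed (epochQueries C T δ)) : ℝ :=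
  epochs R η P (epochQueries C T δ) x₀ (numEpochs C T δ) ω

end ActiveThreshold

end

namespace ActiveThreshold

/-! Rate. Put `a = C_δ̃ / √N`. The lower half of the TNC, integrated from `t`, gives `c |x - t| ^ k
≤ excessRisk η t x` on `[0, R]` (`TNC.excessRisk_ge`). Consider an epoch of radius `r` that
succeeds. If `t` lies in its search region, `t` is an admissible competitor and the new risk is at
most `a r`. Either the new point is within `r / 2` of `t`, so that the next region contains `t`
again, or `c (r / 2) ^ k ≤ a r`, which forces `r ≤ ρ` with `ρ = (2 ^ k a / c) ^ (1 / (k - 1))`. If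
`t` lies outside, the centre itself is the competitor and the risk grows by at most `a r`. Radii
halve, so all growth after a loss sums geometrically, and the final risk is at most `max (2 a R / 2
^ E) (2 a ρ)` (`IsOptimalPassive.epochs_risk_le`). Both `a` and `2 ^ (-E)` are `T ^ (-1 / 2)` up to
logarithms, so the second term has order `a ^ (k / (k - 1))`, that is `T ^ (-k / (2k - 2))`, and the
first has order `1 / T`, which is no larger because `k ≥ 2`. A union bound over at most `log T / 2`
epochs costs confidence `δ`.

Existence. Empirical risk minimization works. An excess risk above `ε` means that the minimizer
passes the best point `p` of the region, on one side, by a stretch on which `|2η - 1|` has integral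
above `ε`, although the labels between `p` and the output do not favour the true sign. Ordered by
position, the labels beyond `p` have means of constant sign, so an exponential supermartingale and
Ville's inequality control all possible outputs at once, without a logarithmic loss
(`measure_exists_initialSegment_sum_nonpos_le`, `measure_overshoot_le`). -/

/-! ### Excess risk and its lower bound under the noise condition. -/

theorem excessRisk_eq_abs (η : ℝ → ℝ) (t x : ℝ) :
    excessRisk η t x = |(∫ z in t..x, |2 * η z - 1|)| := by
  unfold excessRisk
  rcases le_total x t with h | h
  · rw [min_eq_left h, max_eq_right h, intervalIntegral.integral_symm x t, abs_neg, abs_of_nonneg]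
    exact intervalIntegral.integral_nonneg h fun _ _ => abs_nonneg _
  · rw [min_eq_right h, max_eq_left h, abs_of_nonneg]
    exact intervalIntegral.integral_nonneg h fun _ _ => abs_nonneg _

theorem excessRisk_self (η : ℝ → ℝ) (t : ℝ) : excessRisk η t t = 0 := by
  simp [excessRisk]

theorem IsThreshold.integrableOn {s R t : ℝ} {η : ℝ → ℝ} (h : IsThreshold s R η t) :
    IntegrableOn (fun z => |2 * η z - 1|) (Icc 0 R) := by
  refine Measure.integrableOn_of_bounded (M := 1) (by simp) ?_ ?_
  · have := h.measurable
    exact Measurable.aestronglyMeasurable (by fun_prop)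
  · refine (ae_restrict_iff' measurableSet_Icc).2 (ae_of_all _ fun x hx => ?_)
    obtain ⟨h0, h1⟩ := h.prob x hx
    rw [Real.norm_eq_abs, abs_abs, abs_le]
    constructor <;> linarith

theorem IsThreshold.intervalIntegrable {s R t : ℝ} {η : ℝ → ℝ} (h : IsThreshold s R η t)
    {x y : ℝ} (hx : x ∈ Icc 0 R) (hy : y ∈ Icc 0 R) :
    IntervalIntegrable (fun z => |2 * η z - 1|) volume x y :=
  (h.integrableOn.mono_set (uIcc_subset_Icc hx hy)).intervalIntegrable

/-- The excess risk agrees on `[0, R]` with a function that is continuous everywhere. -/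
theorem IsThreshold.exists_continuous {s R t : ℝ} {η : ℝ → ℝ} (h : IsThreshold s R η t) :
    ∃ G : ℝ → ℝ, Continuous G ∧ ∀ x ∈ Icc 0 R, G x = excessRisk η t x := by
  have hi : Integrable ((Icc 0 R).indicator fun z => |2 * η z - 1|) :=
    h.integrableOn.integrable_indicator measurableSet_Icc
  -- Outside `[0, R]` nothing bounds `η`; cutting off there makes the integrand integrable on the
  -- whole line, hence its primitive continuous.
  refine ⟨fun x => |∫ z in t..x, (Icc 0 R).indicator (fun z => |2 * η z - 1|) z|, ?_, ?_⟩
  · exact (intervalIntegral.continuous_primitive (fun a b => hi.intervalIntegrable) t).abs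
  · intro x hx
    rw [excessRisk_eq_abs]
    refine congrArg abs (intervalIntegral.integral_congr fun z hz => ?_)
    exact indicator_of_mem (uIcc_subset_Icc h.mem hx hz) _

/-- This removes the restriction `|η x - 1 / 2| ≤ ε₀`: where it fails, `ε₀` itself is a lower bound,
and `|x - t| ≤ R` turns it into a multiple of `|x - t| ^ (k - 1)`. -/
theorem TNC.lower_bound {R t k μ M ε₀ : ℝ} {η : ℝ → ℝ} (hR : 0 < R) (hk : 2 ≤ k)
    (hε : 0 < ε₀) (h : TNC R η t k μ M ε₀) (ht : t ∈ Icc 0 R) {x : ℝ} (hx : x ∈ Icc 0 R) :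
    min μ (ε₀ / R ^ (k - 1)) * |x - t| ^ (k - 1) ≤ |η x - 1 / 2| := by
  have hp : 0 ≤ |x - t| ^ (k - 1) := by positivity
  rcases le_or_gt |η x - 1 / 2| ε₀ with hc | hc
  · exact (mul_le_mul_of_nonneg_right (min_le_left _ _) hp).trans (h x hx hc).1
  · refine (mul_le_mul_of_nonneg_right (min_le_right _ _) hp).trans (le_trans ?_ hc.le)
    have hRk : 0 < R ^ (k - 1) := by positivity
    have : |x - t| ^ (k - 1) ≤ R ^ (k - 1) := by
      refine Real.rpow_le_rpow (abs_nonneg _) ?_ (by linarith)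
      rw [abs_le]; constructor <;> linarith [hx.1, hx.2, ht.1, ht.2]
    rw [div_mul_eq_mul_div, div_le_iff₀ hRk]
    gcongr

theorem integral_abs_sub_rpow {t x k : ℝ} (hk : 2 ≤ k) :
    |∫ z in t..x, |z - t| ^ (k - 1)| = |x - t| ^ k / k := by
  rw [intervalIntegral.integral_comp_sub_right (fun z => |z| ^ (k - 1)) t, sub_self]
  have key : ∀ y : ℝ, 0 ≤ y → ∫ z in (0 : ℝ)..y, |z| ^ (k - 1) = y ^ k / k := by
    intro y hy
    have : ∫ z in (0 : ℝ)..y, |z| ^ (k - 1) = ∫ z in (0 : ℝ)..y, z ^ (k - 1) := by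
      refine intervalIntegral.integral_congr fun z hz => ?_
      rw [uIcc_of_le hy] at hz
      simp only [abs_of_nonneg hz.1]
    rw [this, integral_rpow (Or.inl (by linarith)), Real.zero_rpow (by linarith)]
    simp
  rcases le_total 0 (x - t) with h | h
  · rw [key _ h, abs_of_nonneg h, abs_of_nonneg]
    have := Real.rpow_nonneg h k
    positivity
  · have h' : 0 ≤ -(x - t) := by linarith
    have := intervalIntegral.integral_comp_neg (a := 0) (b := -(x - t))
      (fun z : ℝ => |z| ^ (k - 1))
    simp only [abs_neg, neg_neg, neg_zero] at this
    rw [intervalIntegral.integral_symm, abs_neg, ← this, key _ h', abs_of_nonpos h, abs_of_nonneg]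
    have := Real.rpow_nonneg h' k
    positivity

theorem TNC.excessRisk_ge {s R t k μ M ε₀ : ℝ} {η : ℝ → ℝ} (hR : 0 < R) (hk : 2 ≤ k)
    (hμ : 0 < μ) (hε : 0 < ε₀) (hη : IsThreshold s R η t) (h : TNC R η t k μ M ε₀) {x : ℝ}
    (hx : x ∈ Icc 0 R) :
    2 * min μ (ε₀ / R ^ (k - 1)) / k * |x - t| ^ k ≤ excessRisk η t x := by
  set c := min μ (ε₀ / R ^ (k - 1))
  have hc : 0 < c := lt_min hμ (by positivity)
  have h1 : 2 * c / k * |x - t| ^ k = |∫ z in t..x, 2 * c * |z - t| ^ (k - 1)| := by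
    rw [intervalIntegral.integral_const_mul, abs_mul, integral_abs_sub_rpow hk,
      abs_of_pos (by positivity : 0 < 2 * c)]
    ring
  rw [h1, excessRisk_eq_abs]
  rw [intervalIntegral.abs_intervalIntegral_eq, intervalIntegral.abs_intervalIntegral_eq]
  have hsub : uIoc t x ⊆ Icc 0 R := uIoc_subset_uIcc.trans (uIcc_subset_Icc hη.mem hx)
  have hcont : Continuous fun z : ℝ => 2 * c * |z - t| ^ (k - 1) :=
    continuous_const.mul (((continuous_id.sub continuous_const).abs).rpow_const
      fun _ => Or.inr (by linarith))
  refine abs_le_abs_of_nonneg ?_ ?_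
  · exact setIntegral_nonneg measurableSet_uIoc fun z _ => by positivity
  · refine setIntegral_mono_on ?_ ?_ measurableSet_uIoc fun z hz => ?_
    · exact (hcont.intervalIntegrable t x).def'
    · exact hη.integrableOn.mono_set hsub
    · have := h.lower_bound hR hk hε hη.mem (hsub hz)
      have h2 : |2 * η z - 1| = 2 * |η z - 1 / 2| := by
        rw [← abs_of_pos (two_pos (α := ℝ)), ← abs_mul, abs_of_pos (two_pos (α := ℝ))]
        congr 1; ring
      rw [h2]
      linarith

/-! ### Measurability of the samples and of the iterates. -/

@[fun_prop]
theorem measurable_query {R r : ℝ} :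
    Measurable fun p : ℝ × unitInterval => query R p.1 r p.2 := by
  unfold query
  fun_prop

theorem measurable_label {η : ℝ → ℝ} (hη : Measurable η) :
    Measurable fun p : ℝ × unitInterval => label η p.1 p.2 := by
  unfold label
  refine measurable_to_bool ?_
  have : (fun p : ℝ × unitInterval => decide ((p.2 : ℝ) ≤ η p.1)) ⁻¹' {true} =
      {p | (p.2 : ℝ) ≤ η p.1} := by
    ext p; simp
  rw [this]
  exact measurableSet_le (by fun_prop) (by fun_prop)

theorem measurable_sample {R r : ℝ} {η : ℝ → ℝ} (hη : Measurable η) {N : ℕ} :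
    Measurable fun p : ℝ × (Fin N → unitInterval × unitInterval) => sample R η p.1 r p.2 := by
  unfold sample
  refine measurable_pi_lambda _ fun i => ?_
  have hq : Measurable fun p : ℝ × (Fin N → unitInterval × unitInterval) =>
      query R p.1 r (p.2 i).1 :=
    measurable_query.comp (f := fun p : ℝ × (Fin N → unitInterval × unitInterval) =>
      (p.1, (p.2 i).1)) (by fun_prop)
  exact hq.prodMk ((measurable_label hη).comp (hq.prodMk (by fun_prop)))

theorem IsOptimalPassive.measurable_call {s R : ℝ} {C : ℝ → ℝ} {P : PassiveProcedure}
    (hP : IsOptimalPassive s R C P) {η : ℝ → ℝ} (hη : Measurable η) (r : ℝ) (N : ℕ) :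
    Measurable fun p : ℝ × Seed N => P.call R η p.1 r p.2 := by
  unfold PassiveProcedure.call
  have hs : Measurable fun p : ℝ × Seed N => sample R η p.1 r p.2.1 :=
    (measurable_sample (R := R) (r := r) hη).comp
      (f := fun p : ℝ × Seed N => (p.1, p.2.1)) (by fun_prop)
  exact (hP.measurable r N).comp (measurable_fst.prodMk (hs.prodMk (by fun_prop)))

theorem IsOptimalPassive.measurable_epochs {s R : ℝ} {C : ℝ → ℝ} {P : PassiveProcedure}
    (hP : IsOptimalPassive s R C P) {η : ℝ → ℝ} (hη : Measurable η) (N : ℕ) (x₀ : ℝ) (e : ℕ) :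
    Measurable (epochs R η P N x₀ e) := by
  induction e with
  | zero => exact measurable_const
  | succ e ih =>
    have h1 : Measurable fun ω : Fin (e + 1) → Seed N =>
        epochs R η P N x₀ e (fun i => ω i.castSucc) :=
      ih.comp (measurable_pi_lambda _ fun i => measurable_pi_apply _)
    exact (hP.measurable_call hη (R / 2 ^ e) N).comp (h1.prodMk (measurable_pi_apply _))

/-! ### Propagation of the risk bound through the epochs. -/

theorem IsOptimalPassive.epochs_mem {s R : ℝ} (hR : 0 < R) {C : ℝ → ℝ} {P : PassiveProcedure}
    (hP : IsOptimalPassive s R C P) (η : ℝ → ℝ) (N : ℕ) {x₀ : ℝ} (hx₀ : x₀ ∈ Icc 0 R) (e : ℕ)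
    (ω : Fin e → Seed N) : epochs R η P N x₀ e ω ∈ Icc 0 R := by
  induction e with
  | zero => exact hx₀
  | succ e ih => exact (hP.mem_region _ (ih _) _ (by positivity) _ _ _).1

/-- An invariant that each epoch preserves with probability at least `1 - δ` holds after `e`
epochs with probability at least `1 - e δ`. -/
theorem IsOptimalPassive.epochs_invariant {s R : ℝ} (hR : 0 < R) {C : ℝ → ℝ}
    {P : PassiveProcedure} (hP : IsOptimalPassive s R C P) {η : ℝ → ℝ} (hη : Measurable η)
    {N : ℕ} {x₀ : ℝ} (hx₀ : x₀ ∈ Icc 0 R) {δ : ℝ} (hδ : δ ∈ Ioo (0 : ℝ) 1)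
    (I : ℕ → Set ℝ) (hI : ∀ e, MeasurableSet (I e)) (h0 : x₀ ∈ I 0)
    (hstep : ∀ e, ∀ x ∈ Icc 0 R, x ∈ I e → ENNReal.ofReal (1 - δ) ≤
      volume {z : Seed N | P.call R η x (R / 2 ^ e) z ∈ I (e + 1)}) (e : ℕ) :
    ENNReal.ofReal (1 - e * δ) ≤
      volume {ω : Fin e → Seed N | epochs R η P N x₀ e ω ∈ I e} := by
  induction e with
  | zero =>
    have : {ω : Fin 0 → Seed N | epochs R η P N x₀ 0 ω ∈ I 0} = univ := by
      ext ω; simpa [epochs] using h0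
    rw [this]; simp
  | succ e ih =>
    -- Splitting off the seed of the last epoch: it is independent of the past, so Fubini allows
    -- `hstep` to be applied with the past fixed.
    have hpres := volume_preserving_piFinSuccAbove (fun _ : Fin (e + 1) => Seed N) (Fin.last e)
    set A : Set (Fin e → Seed N) := {ω | epochs R η P N x₀ e ω ∈ I e} with hA
    have hAm : MeasurableSet A := hP.measurable_epochs hη N x₀ e (hI e)
    set B : Set (Seed N × (Fin e → Seed N)) :=
      {p | P.call R η (epochs R η P N x₀ e p.2) (R / 2 ^ e) p.1 ∈ I (e + 1)} with hB
    have hBm : MeasurableSet B := by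
      have := (hP.measurable_call hη (R / 2 ^ e) N).comp
        (((hP.measurable_epochs hη N x₀ e).comp measurable_snd).prodMk
          (measurable_fst (α := Seed N) (β := Fin e → Seed N)))
      exact this (hI (e + 1))
    have hpre : {ω : Fin (e + 1) → Seed N | epochs R η P N x₀ (e + 1) ω ∈ I (e + 1)} =
        MeasurableEquiv.piFinSuccAbove (fun _ : Fin (e + 1) => Seed N) (Fin.last e) ⁻¹' B := by
      ext ω
      simp [hB, epochs, MeasurableEquiv.piFinSuccAbove, Fin.init_def]
    rw [hpre, hpres.measure_preimage hBm.nullMeasurableSet]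
    change _ ≤ ((volume : Measure (Seed N)).prod volume) B
    rw [Measure.prod_apply_symm hBm]
    have hle : ∫⁻ ω in A, ENNReal.ofReal (1 - δ) ≤
        ∫⁻ ω : Fin e → Seed N, volume ((fun z : Seed N => (z, ω)) ⁻¹' B) :=
      (setLIntegral_mono' hAm fun ω hω =>
        hstep e _ (hP.epochs_mem hR η N hx₀ e ω) hω).trans (setLIntegral_le_lintegral _ _)
    refine le_trans ?_ hle
    rw [setLIntegral_const]
    refine le_trans ?_ (mul_le_mul_right ih _)
    rw [← ENNReal.ofReal_mul (by linarith [hδ.2])]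
    refine ENNReal.ofReal_le_ofReal ?_
    push_cast
    -- `(1 - δ) (1 - e δ)` exceeds `1 - (e + 1) δ` by `e δ ^ 2`.
    nlinarith [mul_nonneg (Nat.cast_nonneg (α := ℝ) e) (sq_nonneg δ)]

/-- Risk of the iterates, if every epoch succeeds with probability `1 - δ`: here `ρ` bounds the
radius of any epoch that loses the threshold. -/
theorem IsOptimalPassive.epochs_risk_le {s R : ℝ} (hR : 0 < R) {C : ℝ → ℝ}
    {P : PassiveProcedure} (hP : IsOptimalPassive s R C P) {η : ℝ → ℝ} {t : ℝ}
    (hη : IsThreshold s R η t) {N : ℕ} (hN : 1 ≤ N) {x₀ : ℝ} (hx₀ : x₀ ∈ Icc 0 R) {δ : ℝ}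
    (hδ : δ ∈ Ioo (0 : ℝ) 1) {a c k ρ : ℝ} (ha : a = C δ / √N) (ha0 : 0 ≤ a) (hc : 0 ≤ c)
    (hk : 0 ≤ k) (hlow : ∀ x ∈ Icc 0 R, c * |x - t| ^ k ≤ excessRisk η t x)
    (hρ : ∀ r > 0, c * (r / 2) ^ k ≤ a * r → r ≤ ρ) {e : ℕ} (he : 1 ≤ e) :
    ENNReal.ofReal (1 - e * δ) ≤ volume {ω : Fin e → Seed N |
      excessRisk η t (epochs R η P N x₀ e ω) ≤ max (2 * a * (R / 2 ^ e)) (2 * a * ρ)} := by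
  obtain ⟨G, hGc, hG⟩ := hη.exists_continuous
  have hGm := hGc.measurable
  -- First alternative: the threshold is within the next radius; at `e = 0` nothing is known about
  -- the risk of `x₀`. Second: the threshold may be lost, and the term `- 2 (R / 2 ^ e)` reserves
  -- room for the growth in all later epochs, whose radii sum to less than `2 (R / 2 ^ e)`.
  let I : ℕ → Set ℝ := fun e =>
    {x | (|x - t| ≤ R / 2 ^ e ∧ (e = 0 ∨ G x ≤ 2 * a * (R / 2 ^ e))) ∨
      G x ≤ a * (2 * ρ - 2 * (R / 2 ^ e))}
  have hI : ∀ e, MeasurableSet (I e) := by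
    intro e
    have h1 : MeasurableSet {x : ℝ | |x - t| ≤ R / 2 ^ e} :=
      measurableSet_le (by fun_prop) (by fun_prop)
    have h2 : MeasurableSet {x : ℝ | G x ≤ 2 * a * (R / 2 ^ e)} :=
      measurableSet_le (by fun_prop) (by fun_prop)
    have h3 : MeasurableSet {x : ℝ | G x ≤ a * (2 * ρ - 2 * (R / 2 ^ e))} :=
      measurableSet_le (by fun_prop) (by fun_prop)
    exact (h1.inter ((MeasurableSet.const _).union h2)).union h3
  have h0 : x₀ ∈ I 0 := by
    refine Or.inl ⟨?_, Or.inl rfl⟩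
    have := hη.mem
    rw [pow_zero, div_one, abs_le]
    constructor <;> linarith [hx₀.1, hx₀.2, this.1, this.2]
  have hstep : ∀ e, ∀ x ∈ Icc 0 R, x ∈ I e → ENNReal.ofReal (1 - δ) ≤
      volume {z : Seed N | P.call R η x (R / 2 ^ e) z ∈ I (e + 1)} := by
    intro e x hx hxe
    have hr : 0 < R / 2 ^ e := by positivity
    have hr2 : R / 2 ^ (e + 1) = R / 2 ^ e / 2 := by rw [pow_succ]; field_simp
    set r := R / 2 ^ e with hrdef
    have har : C δ * r / √N = a * r := by rw [ha]; ring
    have hmem : ∀ z : Seed N, P.call R η x r z ∈ Icc 0 R := fun z =>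
      (hP.mem_region x hx r hr N _ _).1
    -- The split is on the distance and not on the alternatives of `I e`, so a lost threshold that
    -- comes back into reach is used again.
    by_cases hnear : |x - t| ≤ r
    · have ht : t ∈ region R x r := by
        rw [abs_le] at hnear
        exact ⟨hη.mem, by linarith, by linarith⟩
      refine (hP.risk_le η t hη x hx r hr N hN δ hδ t ht).trans (measure_mono fun z hz => ?_)
      rw [mem_ofPred_eq, excessRisk_self, sub_zero, har] at hz
      change _ ∨ _
      rw [hr2, hG _ (hmem z)]
      by_cases hz' : |P.call R η x r z - t| ≤ r / 2
      · exact Or.inl ⟨hz', Or.inr (by linarith)⟩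
      · right
        have h1 : c * (r / 2) ^ k ≤ a * r := by
          refine le_trans ?_ ((hlow _ (hmem z)).trans hz)
          have := Real.rpow_le_rpow (by positivity) (not_le.1 hz').le hk
          gcongr
        have := mul_le_mul_of_nonneg_left (hρ r hr h1) ha0
        linarith
    · have hxe' : G x ≤ a * (2 * ρ - 2 * r) := hxe.resolve_left fun h => hnear h.1
      rw [hG x hx] at hxe'
      have hx' : x ∈ region R x r := ⟨hx, by linarith, by linarith⟩
      refine (hP.risk_le η t hη x hx r hr N hN δ hδ x hx').trans (measure_mono fun z hz => ?_)
      rw [mem_ofPred_eq, har] at hz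
      right
      rw [hr2, hG _ (hmem z)]
      linarith
  refine (hP.epochs_invariant hR hη.measurable hx₀ hδ I hI h0 hstep e).trans
    (measure_mono fun ω hω => ?_)
  have hr : 0 < R / 2 ^ e := by positivity
  have hω' : _ ∨ _ := hω
  rw [hG _ (hP.epochs_mem hR η N hx₀ e ω)] at hω'
  rcases hω' with ⟨_, h | h⟩ | h
  · omega
  · exact h.trans (le_max_left _ _)
  · exact (h.trans (by linarith [mul_nonneg ha0 hr.le])).trans (le_max_right _ _)

/-! ### The epoch schedule for large budgets. -/

theorem tendsto_logb_two_natCast :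
    Filter.Tendsto (fun T : ℕ => Real.logb 2 T) Filter.atTop Filter.atTop :=
  (Real.tendsto_logb_atTop one_lt_two).comp tendsto_natCast_atTop_atTop

theorem tendsto_epochConfidence {δ : ℝ} (hδ : 0 < δ) :
    Filter.Tendsto (fun T : ℕ => epochConfidence T δ) Filter.atTop (nhdsWithin 0 (Ioi 0)) := by
  refine tendsto_nhdsWithin_iff.2 ⟨?_, ?_⟩
  · exact Filter.Tendsto.div_atTop tendsto_const_nhds tendsto_logb_two_natCast
  · filter_upwards [tendsto_logb_two_natCast.eventually_gt_atTop 0] with T hT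
    exact div_pos (by linarith) hT

/-- Since `1 / δ̃` is proportional to `log T`, the square of the factor is in fact doubly
logarithmic; the crude `log x ≤ x` costs only a logarithm in the final rate. The summand `1` in the
constant makes it positive. -/
theorem IsConfidenceFactor.exists_sq_le {C : ℝ → ℝ} (hC : IsConfidenceFactor C) {δ : ℝ}
    (hδ : 0 < δ) : ∃ D > 0, ∀ᶠ T : ℕ in Filter.atTop,
      C (epochConfidence T δ) ^ 2 ≤ D * Real.logb 2 T := by
  obtain ⟨c, hc⟩ := hC.2.bound
  refine ⟨c ^ 2 / (2 * δ) + 1, by positivity, ?_⟩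
  filter_upwards [(tendsto_epochConfidence hδ).eventually hc,
    tendsto_logb_two_natCast.eventually_ge_atTop (2 * δ + 1)] with T hT hℓ
  have hℓ0 : 0 < Real.logb 2 T := by linarith
  set ℓ := Real.logb 2 T
  have hinv : 1 / epochConfidence T δ = ℓ / (2 * δ) := by
    unfold epochConfidence; rw [one_div_div]
  rw [hinv, Real.norm_eq_abs, Real.norm_eq_abs] at hT
  have hlog : 0 ≤ Real.log (ℓ / (2 * δ)) :=
    Real.log_nonneg (by rw [le_div_iff₀ (by positivity)]; linarith)
  calc C (epochConfidence T δ) ^ 2 = |C (epochConfidence T δ)| ^ 2 := (sq_abs _).symm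
    _ ≤ (c * |√(Real.log (ℓ / (2 * δ)))|) ^ 2 := by gcongr
    _ = c ^ 2 * Real.log (ℓ / (2 * δ)) := by rw [mul_pow, sq_abs, Real.sq_sqrt hlog]
    _ ≤ c ^ 2 * (ℓ / (2 * δ)) := by
        gcongr
        exact Real.log_le_self (by positivity)
    _ ≤ (c ^ 2 / (2 * δ) + 1) * ℓ := by
        have : c ^ 2 * (ℓ / (2 * δ)) = c ^ 2 / (2 * δ) * ℓ := by ring
        linarith

theorem eventually_mul_logb_sq_le (A : ℝ) :
    ∀ᶠ T : ℕ in Filter.atTop, A * Real.logb 2 T ^ 2 ≤ T := by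
  have h := (Real.isLittleO_pow_log_id_atTop (n := 2)).const_mul_left (A / Real.log 2 ^ 2)
  have h2 := tendsto_natCast_atTop_atTop.eventually (h.bound one_pos)
  filter_upwards [h2] with T hT
  refine le_trans (le_abs_self _) ?_
  simpa [Real.logb, div_pow, abs_div, div_mul_eq_mul_div, mul_div_assoc] using hT

/-- The schedule of the adaptive learner for a large budget. -/
theorem schedule_bounds {C : ℝ → ℝ} {T : ℕ} {δ D : ℝ}
    (hC : √2 < C (epochConfidence T δ)) (hT : 2 ≤ Real.logb 2 T)
    (hD : C (epochConfidence T δ) ^ 2 ≤ D * Real.logb 2 T) (hDT : 2 * D * Real.logb 2 T ^ 2 ≤ T) :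
    1 ≤ numEpochs C T δ ∧ (numEpochs C T δ : ℝ) ≤ Real.logb 2 T / 2 ∧
      1 ≤ epochQueries C T δ ∧ T / Real.logb 2 T ≤ epochQueries C T δ ∧
      1 / 2 ^ numEpochs C T δ ≤ 2 * (√D * Real.logb 2 T / √T) := by
  have hC2 : 2 < C (epochConfidence T δ) ^ 2 := by
    have h0 := Real.sqrt_nonneg 2
    have h1 := Real.sq_sqrt (zero_le_two (α := ℝ))
    nlinarith
  set Q := C (epochConfidence T δ) ^ 2 with hQ
  set ℓ := Real.logb 2 T with hℓ
  have hℓ0 : 0 < ℓ := by linarith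
  have hD0 : 0 < D := by
    by_contra h
    nlinarith
  have hT0 : (0 : ℝ) < T := lt_of_lt_of_le (by positivity) hDT
  have hTℓ : (T : ℝ) = 2 ^ ℓ := (Real.rpow_logb two_pos (by norm_num) hT0).symm
  set q := √(2 * T / (Q * ℓ)) with hq
  have hE : numEpochs C T δ = ⌊Real.logb 2 q⌋₊ := rfl
  -- This is what the `2` in `hDT` is for: it gives `q ≥ 2`, hence at least one epoch.
  have hq4 : 4 ≤ 2 * T / (Q * ℓ) := by
    rw [le_div_iff₀ (by positivity)]
    nlinarith
  have hq2 : 2 ≤ q := Real.le_sqrt_of_sq_le (by norm_num; exact hq4)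
  have hq1 : 1 ≤ Real.logb 2 q := by
    rw [Real.le_logb_iff_rpow_le one_lt_two (by linarith), Real.rpow_one]; exact hq2
  have hE1 : 1 ≤ numEpochs C T δ := by
    rw [hE]; exact Nat.le_floor (by simpa using hq1)
  have hqle : q ≤ √T := by
    refine Real.sqrt_le_sqrt ?_
    rw [div_le_iff₀ (by positivity)]
    nlinarith [mul_pos hT0 hℓ0]
  -- `Q > 2` and `ℓ ≥ 2` yield `q ≤ √T`; the resulting `E ≤ ℓ / 2` matches the factor `2` in `δ̃ = 2
  -- δ / ℓ`.
  have hEℓ : (numEpochs C T δ : ℝ) ≤ ℓ / 2 := by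
    rw [hE]
    refine (Nat.floor_le (by linarith)).trans ?_
    calc Real.logb 2 q ≤ Real.logb 2 (√T) :=
          Real.logb_le_logb_of_le one_lt_two (by linarith) hqle
      _ = ℓ / 2 := by
          rw [Real.sqrt_eq_rpow, Real.logb_rpow_eq_mul_logb_of_pos hT0]; ring
  have hE0 : (0 : ℝ) < numEpochs C T δ := by exact_mod_cast hE1
  have hℓT : ℓ ≤ T := by
    rw [hTℓ]
    have h1 : (1 : ℝ) + ℓ * 1 ≤ (1 + 1) ^ ℓ :=
      one_add_mul_self_le_rpow_one_add (by norm_num) (by linarith)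
    norm_num at h1
    linarith
  have hET : numEpochs C T δ ≤ T := by
    have : (numEpochs C T δ : ℝ) ≤ T := by linarith
    exact_mod_cast this
  have hN1 : 1 ≤ epochQueries C T δ := (Nat.one_le_div_iff hE1).2 hET
  refine ⟨hE1, hEℓ, hN1, ?_, ?_⟩
  -- Rounding down is harmless: `T < (N + 1) E ≤ 2 N (ℓ / 2)`.
  · have h1 : T < (epochQueries C T δ + 1) * numEpochs C T δ := by
      have := Nat.lt_div_mul_add (a := T) (b := numEpochs C T δ) hE1
      unfold epochQueries
      linarith
    have h2 : (T : ℝ) < (epochQueries C T δ + 1) * numEpochs C T δ := by exact_mod_cast h1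
    have hN1' : (1 : ℝ) ≤ epochQueries C T δ := by exact_mod_cast hN1
    rw [div_le_iff₀ hℓ0]
    nlinarith
  · have h1 : q < 2 ^ (numEpochs C T δ + 1) := by
      have h2 : Real.logb 2 q < numEpochs C T δ + 1 := by rw [hE]; exact Nat.lt_floor_add_one _
      rw [Real.logb_lt_iff_lt_rpow one_lt_two (by linarith)] at h2
      exact_mod_cast h2
    have h2 : √T / (√D * ℓ) ≤ q := by
      have : √T / (√D * ℓ) = √(T / (D * ℓ ^ 2)) := by
        rw [Real.sqrt_div' _ (by positivity), Real.sqrt_mul hD0.le, Real.sqrt_sq hℓ0.le]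
      rw [this]
      refine Real.sqrt_le_sqrt ?_
      rw [div_le_div_iff₀ (by positivity) (by positivity)]
      nlinarith [mul_le_mul_of_nonneg_right hD (mul_pos hT0 hℓ0).le,
        mul_pos hT0 (mul_pos hD0 (pow_pos hℓ0 2))]
    have h3 : √T / (√D * ℓ) ≤ 2 * 2 ^ numEpochs C T δ := by
      rw [pow_succ] at h1; linarith
    have hsD := Real.sqrt_pos.2 hD0
    have hsT := Real.sqrt_pos.2 hT0
    rw [div_le_iff₀ (by positivity)] at h3
    rw [← mul_div_assoc, div_le_div_iff₀ (by positivity) hsT]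
    linarith

/-! ### From the epoch bound to the rate in `T`. -/

/-- A radius that no epoch losing the threshold exceeds. -/
theorem radius_le_of_mul_rpow_le {c a k r : ℝ} (hc : 0 < c) (ha : 0 ≤ a) (hk : 2 ≤ k) (hr : 0 < r)
    (h : c * (r / 2) ^ k ≤ a * r) : r ≤ (2 ^ k * a / c) ^ (1 / (k - 1)) := by
  have hk1 : 0 < k - 1 := by linarith
  have h1 : r ^ (k - 1) ≤ 2 ^ k * a / c := by
    rw [Real.rpow_sub_one hr.ne', div_le_div_iff₀ hr hc]
    rw [Real.div_rpow hr.le zero_le_two, mul_div_assoc', div_le_iff₀ (by positivity)] at h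
    linarith
  rw [one_div]
  exact (Real.le_rpow_inv_iff_of_pos hr.le (by positivity) hk1).2 h1

theorem mul_radius_le {c a b k : ℝ} (hc : 0 < c) (ha : 0 ≤ a) (hab : a ≤ b) (hb : 0 < b)
    (hk : 2 ≤ k) : 2 * a * (2 ^ k * a / c) ^ (1 / (k - 1)) ≤
      2 * (2 ^ k / c) ^ (1 / (k - 1)) * b ^ (k / (k - 1)) := by
  have hk1 : 0 < k - 1 := by linarith
  have h1 : b ^ (k / (k - 1)) = b * b ^ (1 / (k - 1)) := by
    have : k / (k - 1) = 1 + 1 / (k - 1) := by field_simp; ring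
    rw [this, Real.rpow_add hb, Real.rpow_one]
  have h2 : (2 ^ k * a / c) ^ (1 / (k - 1)) ≤ (2 ^ k / c) ^ (1 / (k - 1)) * b ^ (1 / (k - 1)) := by
    rw [← Real.mul_rpow (by positivity) hb.le]
    refine Real.rpow_le_rpow (by positivity) ?_ (by positivity)
    rw [div_mul_eq_mul_div]
    gcongr
  rw [h1]
  calc _ ≤ 2 * b * ((2 ^ k / c) ^ (1 / (k - 1)) * b ^ (1 / (k - 1))) := by gcongr
    _ = _ := by ring

theorem rpow_rate_le {D ℓ T k : ℝ} (hD : 0 < D) (hℓ : 1 ≤ ℓ) (hT : 0 < T) (hk : 2 ≤ k) :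
    (√D * ℓ / √T) ^ (k / (k - 1)) ≤ √D ^ (k / (k - 1)) * ℓ ^ 2 * T ^ (-(k / (2 * k - 2))) := by
  have hk1 : 0 < k - 1 := by linarith
  have hℓ0 : 0 < ℓ := by linarith
  have h1 : √T ^ (k / (k - 1)) = T ^ (k / (2 * k - 2)) := by
    rw [Real.sqrt_eq_rpow, ← Real.rpow_mul hT.le]
    congr 1
    have : 2 * k - 2 = 2 * (k - 1) := by ring
    rw [this]; field_simp
  have h2 : ℓ ^ (k / (k - 1)) ≤ ℓ ^ 2 := by
    rw [← Real.rpow_natCast]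
    refine Real.rpow_le_rpow_of_exponent_le hℓ ?_
    rw [div_le_iff₀ hk1]; push_cast; linarith
  rw [Real.div_rpow (by positivity) (by positivity), Real.mul_rpow (by positivity) hℓ0.le, h1,
    Real.rpow_neg hT.le, div_eq_mul_inv]
  gcongr

/-- The rate of the adaptive learner. -/
theorem adaptiveLearner_rate {R : ℝ} (hR : 0 < R) (s : ℝ) {C : ℝ → ℝ} (hC : IsConfidenceFactor C)
    {k μ M ε₀ δ : ℝ} (hk : 2 ≤ k) (hμ : 0 < μ) (hε : 0 < ε₀) (hδ0 : 0 < δ) (hδ1 : δ < 1) :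
    ∃ (K : ℝ) (p T₀ : ℕ), ∀ T : ℕ, T₀ ≤ T →
      1 ≤ numEpochs C T δ ∧ 1 ≤ epochQueries C T δ ∧
      numEpochs C T δ * epochQueries C T δ ≤ T ∧
      ∀ P : PassiveProcedure, IsOptimalPassive s R C P →
      ∀ (η : ℝ → ℝ) (t : ℝ), IsThreshold s R η t → TNC R η t k μ M ε₀ →
      ∀ x₀ ∈ Set.Icc 0 R,
        ENNReal.ofReal (1 - δ) ≤
          MeasureTheory.volume {ω : Fin (numEpochs C T δ) → Seed (epochQueries C T δ) |
            excessRisk η t (adaptiveLearner R η C P T δ x₀ ω) ≤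
              K * Real.logb 2 T ^ p * (T : ℝ) ^ (-(k / (2 * k - 2)))} := by
  obtain ⟨D, hD0, hD⟩ := hC.exists_sq_le hδ0
  set c := 2 * min μ (ε₀ / R ^ (k - 1)) / k with hc
  have hc0 : 0 < c := by
    have : 0 < min μ (ε₀ / R ^ (k - 1)) := lt_min hμ (by positivity)
    positivity
  obtain ⟨T₀, hT₀⟩ := Filter.eventually_atTop.1 (hD.and ((eventually_mul_logb_sq_le (2 * D)).and
    (tendsto_logb_two_natCast.eventually_ge_atTop 2)))
  -- The two summands of `K` belong to the two terms of the maximum: `2 a R / 2 ^ E ≤ 4 R b ^ 2`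
  -- with `b ^ 2 = D ℓ ^ 2 / T`, and `2 a ρ`. The power `2` of the logarithm serves both, since `k /
  -- (k - 1) ≤ 2`.
  refine ⟨4 * R * D + 2 * (2 ^ k / c) ^ (1 / (k - 1)) * √D ^ (k / (k - 1)), 2, T₀,
    fun T hT => ?_⟩
  obtain ⟨hDT, hDT', hℓ⟩ := hT₀ T hT
  have hℓ0 : 0 < Real.logb 2 T := by linarith
  have hconf : epochConfidence T δ ∈ Ioo (0 : ℝ) 1 := by
    unfold epochConfidence
    refine ⟨by positivity, ?_⟩
    rw [div_lt_one hℓ0]; linarith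
  have hCs := hC.1 _ hconf
  obtain ⟨hE1, hEℓ, hN1, hNT, hEpow⟩ := schedule_bounds hCs hℓ hDT hDT'
  refine ⟨hE1, hN1, Nat.mul_div_le _ _, fun P hP η t hη htnc x₀ hx₀ => ?_⟩
  have hT0 : (0 : ℝ) < T := lt_of_lt_of_le (by positivity) hDT'
  have hT1 : (1 : ℝ) ≤ T := by exact_mod_cast (by exact_mod_cast hT0 : 0 < T)
  have hk1 : 0 < k - 1 := by linarith
  have hCpos : 0 < C (epochConfidence T δ) := (Real.sqrt_nonneg 2).trans_lt hCs
  set E := numEpochs C T δ with hE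
  set N := epochQueries C T δ with hN
  set ℓ := Real.logb 2 T with hℓdef
  set a := C (epochConfidence T δ) / √N with ha
  set b := √D * ℓ / √T with hb
  have hN0 : (0 : ℝ) < N := by exact_mod_cast hN1
  have ha0 : 0 ≤ a := by positivity
  have hb0 : 0 < b := by positivity
  have hab : a ≤ b := by
    have h1 : C (epochConfidence T δ) ≤ √(D * ℓ) := Real.le_sqrt_of_sq_le hDT
    have h2 : √(T / ℓ) ≤ √N := Real.sqrt_le_sqrt hNT
    have h3 : b = √(D * ℓ) / √(T / ℓ) := by
      rw [hb, Real.sqrt_mul hD0.le, Real.sqrt_div hT0.le, div_div_eq_mul_div, mul_assoc,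
        Real.mul_self_sqrt hℓ0.le]
    rw [h3, ha]
    have : 0 < √(T / ℓ) := Real.sqrt_pos.2 (by positivity)
    gcongr
  have hmain := hP.epochs_risk_le hR hη hN1 hx₀ hconf ha ha0 hc0.le (by linarith : 0 ≤ k)
    (fun x hx => htnc.excessRisk_ge hR hk hμ hε hη hx)
    (fun r hr h => radius_le_of_mul_rpow_le hc0 ha0 hk hr h) hE1
  refine le_trans (ENNReal.ofReal_le_ofReal ?_) (hmain.trans (measure_mono fun ω hω => ?_))
  · have : (E : ℝ) * epochConfidence T δ ≤ δ := by
      unfold epochConfidence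
      rw [← mul_div_assoc, div_le_iff₀ hℓ0]
      nlinarith
    linarith
  · have hrate0 : 0 ≤ (T : ℝ) ^ (-(k / (2 * k - 2))) := by positivity
    refine le_trans (show excessRisk η t (adaptiveLearner R η C P T δ x₀ ω) ≤ _ from hω)
      (max_le ?_ ?_)
    · have h1 : 2 * a * (R / 2 ^ E) ≤ 4 * R * D * ℓ ^ 2 * (T : ℝ)⁻¹ := by
        calc 2 * a * (R / 2 ^ E) = 2 * R * (a * (1 / 2 ^ E)) := by ring
          _ ≤ 2 * R * (b * (2 * b)) := by gcongr
          _ = 4 * R * b ^ 2 := by ring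
          _ = _ := by
            rw [hb, div_pow, mul_pow, Real.sq_sqrt hD0.le, Real.sq_sqrt hT0.le]; ring
      have h2 : (T : ℝ)⁻¹ ≤ (T : ℝ) ^ (-(k / (2 * k - 2))) := by
        rw [← Real.rpow_neg_one]
        refine Real.rpow_le_rpow_of_exponent_le hT1 (neg_le_neg ?_)
        rw [div_le_one (by linarith)]; linarith
      refine h1.trans ?_
      refine (mul_le_mul_of_nonneg_left h2 (by positivity)).trans ?_
      rw [add_mul, add_mul]
      exact le_add_of_nonneg_right (by positivity)
    · refine (mul_radius_le hc0 ha0 hab hb0 hk).trans ?_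
      refine (mul_le_mul_of_nonneg_left (rpow_rate_le hD0 (by linarith) hT0 hk)
        (by positivity)).trans ?_
      rw [add_mul, add_mul]
      refine le_trans (le_of_eq ?_) (le_add_of_nonneg_left (by positivity))
      ring

/-! ### Maximal and concentration inequalities for ranked samples. -/

theorem measurableSet_exists_finset_le {Ω ι : Type*} [MeasurableSpace Ω] [Fintype ι]
    {p : Finset ι → Prop} {x : Ω → ℝ} {g : ι → Ω → ℝ} (hx : Measurable x)
    (hg : ∀ i, Measurable (g i)) :
    MeasurableSet {ω | ∃ S : Finset ι, p S ∧ x ω ≤ ∑ i ∈ S, g i ω} := by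
  have : {ω | ∃ S : Finset ι, p S ∧ x ω ≤ ∑ i ∈ S, g i ω} =
      ⋃ S : Finset ι, {ω | p S} ∩ {ω | x ω ≤ ∑ i ∈ S, g i ω} := by
    ext ω; simp
  rw [this]
  exact MeasurableSet.iUnion fun S => (MeasurableSet.const _).inter
    (measurableSet_le hx (Finset.measurable_sum _ fun i _ => hg i))

/-- A maximal inequality of Ville's type: the partial sums run over the initial segments of an
arbitrary ranking `X` of independent summands with exponential moment at most one. -/
theorem measure_exists_initialSegment_sum_ge_le {α : Type} [MeasureSpace α]
    [IsProbabilityMeasure (volume : Measure α)] (n : ℕ) (X : Fin n → ℝ) (g : Fin n → α → ℝ)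
    (hg : ∀ i, Measurable (g i))
    (hint : ∀ i, ∫⁻ v, ENNReal.ofReal (Real.exp (g i v)) ≤ 1) (x : ℝ) :
    volume {v : Fin n → α | ∃ S : Finset (Fin n), (∀ i ∈ S, ∀ j, X j ≤ X i → j ∈ S) ∧
      x ≤ ∑ i ∈ S, g i (v i)} ≤ ENNReal.ofReal (Real.exp (-x)) := by
  induction n generalizing x with
  | zero =>
    rcases le_or_gt x 0 with hx | hx
    · refine prob_le_one.trans ?_
      rw [ENNReal.one_le_ofReal]; exact Real.one_le_exp (by linarith)
    · rw [show {v : Fin 0 → α | ∃ S : Finset (Fin 0), (∀ i ∈ S, ∀ j, X j ≤ X i → j ∈ S) ∧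
        x ≤ ∑ i ∈ S, g i (v i)} = ∅ from ?_]
      · simp
      · refine eq_empty_of_forall_notMem fun v ⟨S, _, hS⟩ => ?_
        rw [Subsingleton.elim S ∅, Finset.sum_empty] at hS
        linarith
  | succ n ih =>
    rcases le_or_gt x 0 with hx | hx
    · refine prob_le_one.trans ?_
      rw [ENNReal.one_le_ofReal]; exact Real.one_le_exp (by linarith)
    -- Since `x > 0`, a segment that counts is nonempty and so contains the lowest-ranked index.
    -- Fixing its variable leaves the same problem for `n` variables at level `x - g i₀`, and
    -- integrating `exp (g i₀)` costs a factor of at most one.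
    obtain ⟨i₀, hi₀⟩ := Finite.exists_min X
    have hpres := volume_preserving_piFinSuccAbove (fun _ : Fin (n + 1) => α) i₀
    set B : Set (α × (Fin n → α)) := {p | ∃ S : Finset (Fin n),
      (∀ i ∈ S, ∀ j, X (i₀.succAbove j) ≤ X (i₀.succAbove i) → j ∈ S) ∧
        x - g i₀ p.1 ≤ ∑ i ∈ S, g (i₀.succAbove i) (p.2 i)} with hB
    have hBm : MeasurableSet B :=
      measurableSet_exists_finset_le (measurable_const.sub ((hg i₀).comp measurable_fst))
        fun i => (hg _).comp ((measurable_pi_apply i).comp measurable_snd)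
    have hsub : {v : Fin (n + 1) → α | ∃ S : Finset (Fin (n + 1)),
        (∀ i ∈ S, ∀ j, X j ≤ X i → j ∈ S) ∧ x ≤ ∑ i ∈ S, g i (v i)} ⊆
        MeasurableEquiv.piFinSuccAbove (fun _ : Fin (n + 1) => α) i₀ ⁻¹' B := by
      rintro v ⟨S, hS, hxS⟩
      have hne : S.Nonempty := by
        by_contra h
        rw [Finset.not_nonempty_iff_eq_empty.1 h, Finset.sum_empty] at hxS
        linarith
      obtain ⟨i, hi⟩ := hne
      have hi₀S : i₀ ∈ S := hS i hi i₀ (hi₀ i)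
      refine ⟨Finset.univ.filter fun j => i₀.succAbove j ∈ S, ?_, ?_⟩
      · intro i hi j hj
        simp only [Finset.mem_filter, Finset.mem_univ, true_and] at hi ⊢
        exact hS _ hi _ hj
      · have h1 : ∑ i ∈ S, g i (v i) = ∑ i, if i ∈ S then g i (v i) else 0 := by
          rw [Finset.sum_ite_mem, Finset.univ_inter]
        rw [h1, Fin.sum_univ_succAbove _ i₀, if_pos hi₀S] at hxS
        rw [Finset.sum_filter]
        change x - g i₀ (v i₀) ≤ ∑ j, if i₀.succAbove j ∈ S
          then g (i₀.succAbove j) (v (i₀.succAbove j)) else 0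
        linarith
    refine (measure_mono hsub).trans ?_
    rw [hpres.measure_preimage hBm.nullMeasurableSet]
    change ((volume : Measure α).prod volume) B ≤ _
    rw [Measure.prod_apply hBm]
    calc ∫⁻ w, volume (Prod.mk w ⁻¹' B)
        ≤ ∫⁻ w, ENNReal.ofReal (Real.exp (-x)) * ENNReal.ofReal (Real.exp (g i₀ w)) := by
          refine lintegral_mono fun w => ?_
          refine (ih (fun j => X (i₀.succAbove j)) (fun j => g (i₀.succAbove j))
            (fun _ => hg _) (fun _ => hint _) (x - g i₀ w)).trans (le_of_eq ?_)
          rw [← ENNReal.ofReal_mul (Real.exp_nonneg _), ← Real.exp_add]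
          congr 2; ring
      _ = ENNReal.ofReal (Real.exp (-x)) * ∫⁻ w, ENNReal.ofReal (Real.exp (g i₀ w)) :=
          lintegral_const_mul _ (by have := hg i₀; fun_prop)
      _ ≤ _ := mul_le_of_le_one_right' (hint i₀)

/-- Hoeffding's lemma for a variable with values in `[-1, 1]`. -/
theorem lintegral_exp_centered_le_one {α : Type} [MeasureSpace α]
    [IsProbabilityMeasure (volume : Measure α)] {W : α → ℝ} (hW : Measurable W)
    (hb : ∀ v, W v ∈ Icc (-1 : ℝ) 1) {h : ℝ} (hh : ∫ v, W v = h) (l : ℝ) :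
    ∫⁻ v, ENNReal.ofReal (Real.exp (-l * W v + l * h - l ^ 2 / 2)) ≤ 1 := by
  have hsg := ProbabilityTheory.hasSubgaussianMGF_of_mem_Icc (μ := (volume : Measure α))
    hW.aemeasurable (ae_of_all _ hb)
  have h1 := hsg.mgf_le (-l)
  have h2 := (hsg.integrable_exp_mul (-l)).const_mul (Real.exp (-(l ^ 2 / 2)))
  rw [hh] at h1 h2
  have h3 : ∀ v, Real.exp (-l * W v + l * h - l ^ 2 / 2) =
      Real.exp (-(l ^ 2 / 2)) * Real.exp (-l * (W v - h)) := by
    intro v; rw [← Real.exp_add]; congr 1; ring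
  simp_rw [h3]
  rw [← ofReal_integral_eq_lintegral_ofReal h2 (ae_of_all _ fun v => by positivity),
    ENNReal.ofReal_le_one, integral_const_mul]
  unfold ProbabilityTheory.mgf at h1
  refine (mul_le_mul_of_nonneg_left h1 (Real.exp_nonneg _)).trans ?_
  rw [← Real.exp_add, Real.exp_le_one_iff]
  norm_num

/-- `(1 - x + x ^ 2 / 2) (1 + x + x ^ 2 / 2) = 1 + x ^ 4 / 4 ≥ 1`, and the second factor is at most
`exp x`. -/
theorem exp_neg_le_quadratic {x : ℝ} (hx : 0 ≤ x) : Real.exp (-x) ≤ 1 - x + x ^ 2 / 2 := by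
  have h1 := Real.quadratic_le_exp_of_nonneg hx
  have h2 : Real.exp (-x) * Real.exp x = 1 := by rw [← Real.exp_add]; simp
  have h3 : 0 ≤ Real.exp (-x) := Real.exp_nonneg _
  have h4 : 0 < 1 - x + x ^ 2 / 2 := by nlinarith [sq_nonneg (x - 1)]
  nlinarith [mul_le_mul_of_nonneg_left h1 h3, sq_nonneg (x ^ 2),
    mul_nonneg (mul_nonneg h3 h4.le) (sub_nonneg.2 h1)]

theorem integral_exp_neg_mul_le {α : Type} [MeasureSpace α]
    [IsProbabilityMeasure (volume : Measure α)] {φ : α → ℝ} (hφ : Measurable φ)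
    (hb : ∀ u, φ u ∈ Icc (0 : ℝ) 1) {l : ℝ} (hl : 0 ≤ l) :
    ∫ u, Real.exp (-(l * φ u)) ≤ Real.exp (-((l - l ^ 2 / 2) * ∫ u, φ u)) := by
  have hi : Integrable φ := Integrable.of_mem_Icc 0 1 hφ.aemeasurable (ae_of_all _ hb)
  calc ∫ u, Real.exp (-(l * φ u)) ≤ ∫ u, (1 - (l - l ^ 2 / 2) * φ u) := by
        refine integral_mono_of_nonneg (ae_of_all _ fun u => Real.exp_nonneg _)
          ((integrable_const _).sub (hi.const_mul _)) (ae_of_all _ fun u => ?_)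
        obtain ⟨h0, h1⟩ := hb u
        have := exp_neg_le_quadratic (mul_nonneg hl h0)
        have h2 : φ u ^ 2 ≤ φ u := by nlinarith
        have h3 := mul_le_mul_of_nonneg_left h2 (sq_nonneg l)
        simp only
        nlinarith
    _ = 1 - (l - l ^ 2 / 2) * ∫ u, φ u := by
        rw [integral_sub (integrable_const _) (hi.const_mul _), integral_const_mul]
        simp
    _ ≤ _ := by
        have := Real.add_one_le_exp (-((l - l ^ 2 / 2) * ∫ u, φ u))
        linarith

/-- Independent pairs `(u, v)` are ranked by `X u`, and `W u v ∈ [-1, 1]` has nonnegative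
conditional mean `h u` given `u`. It is unlikely that an initial segment of the ranking that
contains all pairs with `u ∈ B` has a nonpositive sum of `W`, if `h` has large integral on `B`. -/
theorem measure_exists_initialSegment_sum_nonpos_le {α : Type} [MeasureSpace α]
    [IsProbabilityMeasure (volume : Measure α)] {N : ℕ} {X : α → ℝ} (hX : Measurable X)
    {W : α → α → ℝ} (hW : Measurable (Function.uncurry W)) (hWb : ∀ u v, W u v ∈ Icc (-1 : ℝ) 1)
    {h : α → ℝ} (hhm : Measurable h) (hh : ∀ u, ∫ v, W u v = h u)
    (hh01 : ∀ u, h u ∈ Icc (0 : ℝ) 1)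
    {B : Set α} (hB : MeasurableSet B) {m : ℝ} (hm : ∫ u, B.indicator h u = m) :
    volume {z : Fin N → α × α | ∃ S : Finset (Fin N),
      (∀ i ∈ S, ∀ j, X (z j).1 ≤ X (z i).1 → j ∈ S) ∧ (∀ i, (z i).1 ∈ B → i ∈ S) ∧
        ∑ i ∈ S, W (z i).1 (z i).2 ≤ 0} ≤ ENNReal.ofReal (Real.exp (-(N * m ^ 2 / 4))) := by
  have hφm : Measurable (B.indicator h) := hhm.indicator hB
  have hφ01 : ∀ u, B.indicator h u ∈ Icc (0 : ℝ) 1 := fun u => by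
    by_cases hu : u ∈ B
    · rw [indicator_of_mem hu]; exact hh01 u
    · rw [indicator_of_notMem hu]; exact ⟨le_rfl, zero_le_one⟩
  have hφi : Integrable (B.indicator h) := Integrable.of_mem_Icc 0 1 hφm.aemeasurable
    (ae_of_all _ hφ01)
  have hm0 : 0 ≤ m := hm ▸ integral_nonneg fun u => (hφ01 u).1
  have hm1 : m ≤ 1 := by
    rw [← hm]
    refine (integral_mono hφi (integrable_const 1) fun u => (hφ01 u).2).trans ?_
    simp
  -- With this tilt the final exponent per sample is `m ^ 2 / 8 - m ^ 2 / 2 + m ^ 3 / 8`, at most `-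
  -- m ^ 2 / 4` because `m ≤ 1`.
  set l := m / 2 with hl
  have hl0 : 0 ≤ l := by positivity
  -- The level depends on the `u` only. Given these, a bad segment makes the sum of the compensated
  -- increments `g` reach it, which the maximal inequality bounds by `exp (- x u)`; averaging over
  -- `u` comes last.
  let x : (Fin N → α) → ℝ := fun u => l * ∑ i, B.indicator h (u i) - N * (l ^ 2 / 2)
  let g : α → α → ℝ := fun u v => -l * W u v + l * h u - l ^ 2 / 2
  have hgm : Measurable (Function.uncurry g) := by
    have : Function.uncurry g = fun p : α × α =>
        -l * Function.uncurry W p + l * h p.1 - l ^ 2 / 2 := rfl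
    rw [this]; fun_prop
  set A : Set ((Fin N → α) × (Fin N → α)) := {p | ∃ S : Finset (Fin N),
    (∀ i ∈ S, ∀ j, X (p.1 j) ≤ X (p.1 i) → j ∈ S) ∧ x p.1 ≤ ∑ i ∈ S, g (p.1 i) (p.2 i)} with hA
  have hAm : MeasurableSet A := by
    have : A = ⋃ S : Finset (Fin N), (⋂ i ∈ S, ⋂ j ∈ (Sᶜ : Finset (Fin N)),
        {p | X (p.1 i) < X (p.1 j)}) ∩ {p | x p.1 ≤ ∑ i ∈ S, g (p.1 i) (p.2 i)} := by
      ext p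
      simp only [hA, mem_ofPred_eq, mem_iUnion, mem_inter_iff, mem_iInter, Finset.mem_compl]
      refine exists_congr fun S => and_congr_left fun _ => forall₂_congr fun i _ =>
        forall_congr' fun j => ?_
      rw [← not_le]; tauto
    rw [this]
    refine MeasurableSet.iUnion fun S => MeasurableSet.inter ?_ ?_
    · exact Finset.measurableSet_biInter _ fun i _ => Finset.measurableSet_biInter _ fun j _ =>
        measurableSet_lt (by fun_prop) (by fun_prop)
    · refine measurableSet_le (by fun_prop) (Finset.measurable_sum _ fun i _ => ?_)
      exact hgm.comp (f := fun p : (Fin N → α) × (Fin N → α) => (p.1 i, p.2 i)) (by fun_prop)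
  have hpres := volume_measurePreserving_arrowProdEquivProdArrow α α (Fin N)
  have hsub : {z : Fin N → α × α | ∃ S : Finset (Fin N),
      (∀ i ∈ S, ∀ j, X (z j).1 ≤ X (z i).1 → j ∈ S) ∧ (∀ i, (z i).1 ∈ B → i ∈ S) ∧
        ∑ i ∈ S, W (z i).1 (z i).2 ≤ 0} ⊆
      MeasurableEquiv.arrowProdEquivProdArrow α α (Fin N) ⁻¹' A := by
    rintro z ⟨S, hS, hBS, hsum⟩
    refine ⟨S, hS, ?_⟩
    change l * ∑ i, B.indicator h (z i).1 - N * (l ^ 2 / 2) ≤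
      ∑ i ∈ S, (-l * W (z i).1 (z i).2 + l * h (z i).1 - l ^ 2 / 2)
    have h1 : ∑ i, B.indicator h (z i).1 ≤ ∑ i ∈ S, h (z i).1 := by
      have : ∑ i, B.indicator h (z i).1 = ∑ i ∈ S, B.indicator h (z i).1 := by
        refine (Finset.sum_subset (Finset.subset_univ S) fun i _ hi => ?_).symm
        exact indicator_of_notMem (fun hB => hi (hBS i hB)) _
      rw [this]
      exact Finset.sum_le_sum fun i _ => indicator_le_self' (fun _ _ => (hh01 _).1) _
    have h2 : (S.card : ℝ) ≤ N := by
      exact_mod_cast (Finset.card_le_univ S).trans_eq (Fintype.card_fin N)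
    rw [Finset.sum_sub_distrib, Finset.sum_add_distrib, ← Finset.mul_sum, ← Finset.mul_sum,
      Finset.sum_const, nsmul_eq_mul]
    have h3 := mul_le_mul_of_nonneg_left h1 hl0
    have h4 := mul_le_mul_of_nonneg_right h2 (by positivity : 0 ≤ l ^ 2 / 2)
    have h5 := mul_nonpos_of_nonneg_of_nonpos hl0 hsum
    linarith
  refine (measure_mono hsub).trans ?_
  rw [hpres.measure_preimage hAm.nullMeasurableSet]
  change ((volume : Measure (Fin N → α)).prod volume) A ≤ _
  rw [Measure.prod_apply hAm]
  have hexp : ∀ u : Fin N → α, Real.exp (-x u) =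
      Real.exp (N * (l ^ 2 / 2)) * ∏ i, Real.exp (-(l * B.indicator h (u i))) := by
    intro u
    rw [← Real.exp_sum, ← Real.exp_add, Finset.sum_neg_distrib, ← Finset.mul_sum]
    congr 1; simp only [x]; ring
  have hprodi : Integrable fun u : Fin N → α =>
      Real.exp (N * (l ^ 2 / 2)) * ∏ i, Real.exp (-(l * B.indicator h (u i))) := by
    refine Integrable.const_mul (Integrable.of_mem_Icc 0 1 ?_ (ae_of_all _ fun u => ?_)) _
    · exact (Finset.measurable_prod _ fun i _ => by fun_prop).aemeasurable
    · refine ⟨Finset.prod_nonneg fun i _ => Real.exp_nonneg _,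
        Finset.prod_le_one (fun i _ => Real.exp_nonneg _) fun i _ => ?_⟩
      rw [Real.exp_le_one_iff, neg_nonpos]
      exact mul_nonneg hl0 (hφ01 _).1
  calc ∫⁻ u, volume (Prod.mk u ⁻¹' A) ≤ ∫⁻ u, ENNReal.ofReal (Real.exp (-x u)) := by
        refine lintegral_mono fun u => ?_
        refine measure_exists_initialSegment_sum_ge_le N (fun i => X (u i)) (fun i => g (u i))
          (fun i => hgm.comp measurable_prodMk_left) (fun i => ?_) (x u)
        exact lintegral_exp_centered_le_one (hW.comp measurable_prodMk_left) (hWb _) (hh _) l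
    _ = ENNReal.ofReal (Real.exp (N * (l ^ 2 / 2)) *
          (∫ u, Real.exp (-(l * B.indicator h u))) ^ N) := by
        simp_rw [hexp]
        rw [← ofReal_integral_eq_lintegral_ofReal hprodi (ae_of_all _ fun u => by positivity),
          integral_const_mul, integral_fintype_prod_volume_eq_pow
            (fun u => Real.exp (-(l * B.indicator h u))), Fintype.card_fin]
    _ ≤ ENNReal.ofReal (Real.exp (N * (l ^ 2 / 2)) *
          Real.exp (-((l - l ^ 2 / 2) * m)) ^ N) := by
        have h1 := integral_exp_neg_mul_le hφm hφ01 hl0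
        rw [hm] at h1
        have h2 : 0 ≤ ∫ u, Real.exp (-(l * B.indicator h u)) :=
          integral_nonneg fun u => Real.exp_nonneg _
        gcongr
    _ ≤ _ := by
        refine ENNReal.ofReal_le_ofReal ?_
        rw [← Real.exp_nat_mul, ← Real.exp_add, Real.exp_le_exp, hl]
        have hN : (0 : ℝ) ≤ N := Nat.cast_nonneg N
        have h3 : m ^ 3 ≤ m ^ 2 := by nlinarith [sq_nonneg m]
        have h4 : m ^ 2 / 8 - (m / 2 - m ^ 2 / 8) * m + m ^ 2 / 4 ≤ 0 := by nlinarith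
        have h5 := mul_nonpos_of_nonneg_of_nonpos hN h4
        have h6 : N * ((m / 2) ^ 2 / 2) + N * -((m / 2 - (m / 2) ^ 2 / 2) * m) =
          N * (m ^ 2 / 8 - (m / 2 - m ^ 2 / 8) * m + m ^ 2 / 4) - N * m ^ 2 / 4 := by ring
        linarith

/-! ### Empirical risk minimization: definition, minimality, measurability. -/

/-- The point of `[a, b]` closest to `y`. -/
noncomputable def clampTo (a b y : ℝ) : ℝ := max a (min b y)

theorem clampTo_mem {a b : ℝ} (hab : a ≤ b) (y : ℝ) : clampTo a b y ∈ Icc a b :=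
  ⟨le_max_left _ _, max_le hab (min_le_left _ _)⟩

theorem clampTo_of_mem {a b y : ℝ} (hy : y ∈ Icc a b) : clampTo a b y = y := by
  rw [clampTo, min_eq_right hy.2, max_eq_right hy.1]

/-- A label as a sign, positive on the right of the threshold in expectation. -/
noncomputable def labelSign (s : ℝ) (l : Bool) : ℝ := s * (if l then 1 else -1)

/-- The empirical risk of the threshold classifier at `y`, up to an additive constant and
scaling. -/
noncomputable def empiricalRisk (s : ℝ) {N : ℕ} (D : Fin N → ℝ × Bool) (y : ℝ) : ℝ :=
  ∑ i, if (D i).1 ≤ y then labelSign s (D i).2 else 0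

/-- The points among which the empirical risk is minimized: the left end point of `[a, b]` and
the sample points. -/
noncomputable def candidate (a b : ℝ) {N : ℕ} (D : Fin N → ℝ × Bool) : Option (Fin N) → ℝ
  | none => a
  | some i => clampTo a b (D i).1

open Classical in
/-- The largest minimizer of the empirical risk among the candidates in `[a, b]`. -/
noncomputable def ermIcc (s a b : ℝ) {N : ℕ} (D : Fin N → ℝ × Bool) : ℝ :=
  Finset.univ.sup' Finset.univ_nonempty fun j : Option (Fin N) =>
    if ∀ i, empiricalRisk s D (candidate a b D j) ≤ empiricalRisk s D (candidate a b D i)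
    then candidate a b D j else a

/-- Empirical risk minimization over `S ∩ B(x, r)`. -/
noncomputable def erm (s R : ℝ) : PassiveProcedure :=
  fun x r _ D _ => ermIcc s (max 0 (x - r)) (min R (x + r)) D

theorem candidate_mem {a b : ℝ} (hab : a ≤ b) {N : ℕ} (D : Fin N → ℝ × Bool)
    (j : Option (Fin N)) : candidate a b D j ∈ Icc a b := by
  cases j with
  | none => exact ⟨le_rfl, hab⟩
  | some i => exact clampTo_mem hab _

theorem ermIcc_mem {s a b : ℝ} (hab : a ≤ b) {N : ℕ} (D : Fin N → ℝ × Bool) :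
    ermIcc s a b D ∈ Icc a b := by
  obtain ⟨j, -, hj⟩ := Finset.exists_mem_eq_sup' (Finset.univ_nonempty (α := Option (Fin N)))
    fun j : Option (Fin N) =>
      if ∀ i, empiricalRisk s D (candidate a b D j) ≤ empiricalRisk s D (candidate a b D i)
      then candidate a b D j else a
  unfold ermIcc
  rw [hj]
  split_ifs
  · exact candidate_mem hab D j
  · exact ⟨le_rfl, hab⟩

/-- Non-minimizing candidates are replaced by `a`, the lower end of the range of candidates. So if
the supremum is attained at such a default value, it equals `a`, and every genuine minimizer must
equal `a` too. -/
theorem ermIcc_le_candidate {s a b : ℝ} (hab : a ≤ b) {N : ℕ} (D : Fin N → ℝ × Bool)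
    (i : Option (Fin N)) :
    empiricalRisk s D (ermIcc s a b D) ≤ empiricalRisk s D (candidate a b D i) := by
  classical
  set F : Option (Fin N) → ℝ := fun j =>
    if ∀ i, empiricalRisk s D (candidate a b D j) ≤ empiricalRisk s D (candidate a b D i)
    then candidate a b D j else a with hF
  obtain ⟨j, -, hj⟩ := Finset.exists_mem_eq_sup' (Finset.univ_nonempty (α := Option (Fin N))) F
  have hE : ermIcc s a b D = F j := by
    rw [← hj]; unfold ermIcc; congr!
  obtain ⟨j₀, hj₀⟩ := Finite.exists_min fun j => empiricalRisk s D (candidate a b D j)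
  by_cases hc : ∀ i, empiricalRisk s D (candidate a b D j) ≤ empiricalRisk s D (candidate a b D i)
  · rw [hE, hF]
    simp only [if_pos hc]
    exact hc i
  · have h1 : F j = a := by simp only [hF, if_neg hc]
    have h2 : F j₀ ≤ F j := hj ▸ Finset.le_sup' F (Finset.mem_univ j₀)
    have h3 : F j₀ = candidate a b D j₀ := by simp only [hF]; rw [if_pos hj₀]
    have h4 : candidate a b D j₀ = a :=
      le_antisymm (by rw [← h3, ← h1]; exact h2) (candidate_mem hab D j₀).1
    have h5 : ermIcc s a b D = candidate a b D j₀ := hE.trans (h1.trans h4.symm)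
    rw [h5]
    exact hj₀ i

/-- The empirical risk is a step function that jumps only at sample points: its value at `y` is the
one at the last sample point up to `y`, or at `a` if there is none. -/
theorem ermIcc_le {s a b : ℝ} (hab : a ≤ b) {N : ℕ} {D : Fin N → ℝ × Bool}
    (hD : ∀ i, (D i).1 ∈ Icc a b) {y : ℝ} (hy : a ≤ y) :
    empiricalRisk s D (ermIcc s a b D) ≤ empiricalRisk s D y := by
  classical
  by_cases hne : (Finset.univ.filter fun i => (D i).1 ≤ y).Nonempty
  · obtain ⟨j, hj, hmax⟩ := Finset.exists_max_image _ (fun i => (D i).1) hne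
    simp only [Finset.mem_filter, Finset.mem_univ, true_and] at hj hmax
    refine (ermIcc_le_candidate hab D (some j)).trans (le_of_eq ?_)
    rw [candidate, clampTo_of_mem (hD j)]
    refine Finset.sum_congr rfl fun i _ => ?_
    have : (D i).1 ≤ (D j).1 ↔ (D i).1 ≤ y := ⟨fun h => h.trans hj, fun h => hmax i h⟩
    simp only [this]
  · refine (ermIcc_le_candidate hab D none).trans (le_of_eq ?_)
    refine Finset.sum_congr rfl fun i _ => ?_
    have h1 : ¬ (D i).1 ≤ y := fun h => hne ⟨i, by simpa using h⟩
    have h2 : ¬ (D i).1 ≤ candidate a b D none := fun h => h1 (h.trans hy)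
    rw [if_neg h1, if_neg h2]

theorem measurable_labelSign (s : ℝ) : Measurable (labelSign s) := measurable_from_top

theorem measurable_empiricalRisk {s : ℝ} {N : ℕ} {Ω : Type*} [MeasurableSpace Ω]
    {D : Ω → Fin N → ℝ × Bool} {y : Ω → ℝ} (hD : Measurable D) (hy : Measurable y) :
    Measurable fun ω => empiricalRisk s (D ω) (y ω) := by
  unfold empiricalRisk
  refine Finset.measurable_sum _ fun i _ => Measurable.ite ?_ ?_ measurable_const
  · exact measurableSet_le (by fun_prop) hy
  · exact (measurable_labelSign s).comp (by fun_prop)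

theorem measurable_erm (s R r : ℝ) (N : ℕ) :
    Measurable (fun p : ℝ × (Fin N → ℝ × Bool) × unitInterval => erm s R p.1 r N p.2.1 p.2.2) := by
  unfold erm ermIcc
  have hc : ∀ j : Option (Fin N), Measurable fun p : ℝ × (Fin N → ℝ × Bool) × unitInterval =>
      candidate (max 0 (p.1 - r)) (min R (p.1 + r)) p.2.1 j := by
    intro j
    cases j with
    | none => simp only [candidate]; fun_prop
    | some i => simp only [candidate, clampTo]; fun_prop
  have hD : Measurable fun p : ℝ × (Fin N → ℝ × Bool) × unitInterval => p.2.1 := by fun_prop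
  have := Finset.measurable_sup' (Finset.univ_nonempty (α := Option (Fin N)))
    (f := fun j (p : ℝ × (Fin N → ℝ × Bool) × unitInterval) =>
      if ∀ i, empiricalRisk s p.2.1 (candidate (max 0 (p.1 - r)) (min R (p.1 + r)) p.2.1 j) ≤
        empiricalRisk s p.2.1 (candidate (max 0 (p.1 - r)) (min R (p.1 + r)) p.2.1 i)
      then candidate (max 0 (p.1 - r)) (min R (p.1 + r)) p.2.1 j else max 0 (p.1 - r))
    fun j _ => Measurable.ite ?_ (hc j) (by fun_prop)
  · convert this using 1
    ext p
    rw [Finset.sup'_apply]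
  · have : {p : ℝ × (Fin N → ℝ × Bool) × unitInterval | ∀ i,
        empiricalRisk s p.2.1 (candidate (max 0 (p.1 - r)) (min R (p.1 + r)) p.2.1 j) ≤
        empiricalRisk s p.2.1 (candidate (max 0 (p.1 - r)) (min R (p.1 + r)) p.2.1 i)} =
      ⋂ i, {p | empiricalRisk s p.2.1 (candidate (max 0 (p.1 - r)) (min R (p.1 + r)) p.2.1 j) ≤
        empiricalRisk s p.2.1 (candidate (max 0 (p.1 - r)) (min R (p.1 + r)) p.2.1 i)} := by
      ext p; simp
    rw [this]
    exact MeasurableSet.iInter fun i => measurableSet_le (measurable_empiricalRisk hD (hc j))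
      (measurable_empiricalRisk hD (hc i))

/-! ### Overshooting the best point of the search region. -/

theorem region_eq_Icc (R x r : ℝ) : region R x r = Icc (max 0 (x - r)) (min R (x + r)) := by
  rw [region, Icc_inter_Icc]

theorem region_bounds {R x r : ℝ} (hR : 0 < R) (hx : x ∈ Icc 0 R) (hr : 0 < r) :
    max 0 (x - r) < min R (x + r) ∧ min R (x + r) - max 0 (x - r) ≤ 2 * r := by
  obtain ⟨h0, h1⟩ := hx
  refine ⟨max_lt (lt_min hR (by linarith)) (lt_min (by linarith) (by linarith)), ?_⟩
  linarith [min_le_right R (x + r), le_max_right 0 (x - r)]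

theorem query_mem {R x r : ℝ} (h : max 0 (x - r) ≤ min R (x + r)) (u : unitInterval) :
    query R x r u ∈ Icc (max 0 (x - r)) (min R (x + r)) := by
  unfold query
  have h0 := u.2.1
  have h1 := u.2.2
  constructor <;> nlinarith

theorem integral_labelSign {η : ℝ → ℝ} {q : ℝ} (hq : η q ∈ Icc (0 : ℝ) 1) (s : ℝ) :
    ∫ v : unitInterval, labelSign s (label η q v) = s * (2 * η q - 1) := by
  have h1 : ∀ v : unitInterval, labelSign s (label η q v) =
      s * (2 * (Iic (⟨η q, hq⟩ : unitInterval)).indicator 1 v - 1) := by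
    intro v
    unfold labelSign label
    by_cases hv : (v : ℝ) ≤ η q
    · rw [indicator_of_mem (show v ∈ Iic (⟨η q, hq⟩ : unitInterval) from hv)]
      simp [hv]; norm_num
    · rw [indicator_of_notMem (show v ∉ Iic (⟨η q, hq⟩ : unitInterval) from hv)]
      simp [hv]
  simp_rw [h1]
  rw [integral_const_mul, integral_sub, integral_const_mul, integral_indicator_one measurableSet_Iic]
  · simp [measureReal_def, hq.1]
  · exact ((integrable_const (1 : ℝ)).indicator measurableSet_Iic).const_mul 2
  · exact integrable_const _

theorem integral_comp_query {R x r : ℝ} (h : max 0 (x - r) < min R (x + r)) (F : ℝ → ℝ) :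
    ∫ u : unitInterval, F (query R x r u) =
      (∫ z in (max 0 (x - r))..(min R (x + r)), F z) / (min R (x + r) - max 0 (x - r)) := by
  unfold query
  set a := max 0 (x - r)
  set b := min R (x + r)
  rw [unitInterval.measurePreserving_coe.integral_comp unitInterval.measurableEmbedding_coe
    (fun z => F (a + z * (b - a))), integral_Icc_eq_integral_Ioc,
    ← intervalIntegral.integral_of_le zero_le_one]
  have := intervalIntegral.integral_comp_add_mul (a := 0) (b := 1) F (sub_ne_zero.2 h.ne') a
  simp only [mul_comm (b - a)] at this
  rw [this]
  simp [div_eq_inv_mul]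

/-- The projection of `t` onto `[a, b]` lies between `t` and every `y'` in `[a, b]`, so it minimizes
the risk there; the rest is the triangle inequality. -/
theorem clampTo_region_excessRisk {s R t a b : ℝ} {η : ℝ → ℝ} (hη : IsThreshold s R η t)
    (hab : Icc a b ⊆ Icc 0 R) {y y' : ℝ} (hy : y ∈ Icc a b) (hy' : y' ∈ Icc a b) :
    excessRisk η t y - excessRisk η t y' ≤ |(∫ z in (clampTo a b t)..y, |2 * η z - 1|)| := by
  have hle : a ≤ b := hy.1.trans hy.2
  have hp := clampTo_mem hle t
  rw [excessRisk_eq_abs, excessRisk_eq_abs]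
  set p := clampTo a b t with hpdef
  have h1 : |(∫ z in t..p, |2 * η z - 1|)| ≤ |(∫ z in t..y', |2 * η z - 1|)| := by
    refine intervalIntegral.abs_integral_mono_interval ?_ (ae_of_all _ fun z => abs_nonneg _)
      (hη.intervalIntegrable hη.mem (hab hy'))
    rw [hpdef, clampTo]
    intro z hz
    rw [mem_uIoc] at hz ⊢
    rcases le_total t a with h | h
    · have : min b t = t := min_eq_right (h.trans hle)
      rw [this, max_eq_left h] at hz
      rcases hz with hz | hz
      · exact Or.inl ⟨hz.1, hz.2.trans hy'.1⟩
      · linarith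
    · rcases le_total b t with h' | h'
      · rw [min_eq_left h', max_eq_right hle] at hz
        rcases hz with hz | hz
        · linarith
        · exact Or.inr ⟨hy'.2.trans_lt hz.1, hz.2⟩
      · rw [min_eq_right h', max_eq_right h] at hz
        rcases hz with hz | hz <;> linarith
  have h2 := intervalIntegral.integral_add_adjacent_intervals
    (hη.intervalIntegrable hη.mem (hab hp)) (hη.intervalIntegrable (hab hp) (hab hy))
  rw [← h2]
  have h3 := abs_add_le (∫ z in t..p, |2 * η z - 1|) (∫ z in p..y, |2 * η z - 1|)
  linarith

theorem labelSign_mem {s : ℝ} (hs : s = 1 ∨ s = -1) (l : Bool) :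
    labelSign s l ∈ Icc (-1 : ℝ) 1 := by
  unfold labelSign
  rcases hs with rfl | rfl <;> cases l <;> norm_num

/-- One-sided overshooting: the labels of the queries in `J` favour the sign `κ` on average, but
an initial segment of the queries, in the order given by `κ`, does not show it, although it
contains all queries in the interval `(p, q]`. -/
theorem measure_overshoot_le {s R t x r κ p q : ℝ} {η : ℝ → ℝ} (hs : s = 1 ∨ s = -1)
    (hκ : κ = 1 ∨ κ = -1) (hη : IsThreshold s R η t)
    (hab : max 0 (x - r) < min R (x + r)) {J : Set ℝ} (hJ : MeasurableSet J)
    (hsign : ∀ z ∈ Icc (max 0 (x - r)) (min R (x + r)), z ∈ J → 0 ≤ κ * (s * (2 * η z - 1)))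
    (hp : max 0 (x - r) ≤ p) (hpq : p ≤ q) (hq : q ≤ min R (x + r)) (hpqJ : Ioc p q ⊆ J) (N : ℕ) :
    volume {z : Fin N → unitInterval × unitInterval | ∃ S : Finset (Fin N),
      (∀ i ∈ S, ∀ j, κ * query R x r (z j).1 ≤ κ * query R x r (z i).1 → j ∈ S) ∧
      (∀ i, query R x r (z i).1 ∈ Ioc p q → i ∈ S) ∧
      ∑ i ∈ S, J.indicator (fun w => κ * labelSign s (label η w (z i).2))
        (query R x r (z i).1) ≤ 0} ≤
      ENNReal.ofReal (Real.exp (-(N * ((∫ z in p..q, |2 * η z - 1|) /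
        (min R (x + r) - max 0 (x - r))) ^ 2 / 4))) := by
  have hsub : Icc (max 0 (x - r)) (min R (x + r)) ⊆ Icc 0 R :=
    Icc_subset_Icc (le_max_left _ _) (min_le_left _ _)
  have hqm : Measurable fun u => query R x r u :=
    measurable_query.comp (f := fun u : unitInterval => (x, u)) (by fun_prop)
  have hmem := query_mem hab.le
  have habs : ∀ z ∈ Icc 0 R, |κ * (s * (2 * η z - 1))| = |2 * η z - 1| := by
    intro z _
    rcases hs with rfl | rfl <;> rcases hκ with rfl | rfl <;> simp [abs_sub_comm]
  have hηm := hη.measurable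
  refine measure_exists_initialSegment_sum_nonpos_le (hqm.const_mul κ)
    (W := fun u v => J.indicator (fun w => κ * labelSign s (label η w v)) (query R x r u))
    (h := fun u => J.indicator (fun w => κ * (s * (2 * η w - 1))) (query R x r u))
    (B := {u | query R x r u ∈ Ioc p q}) ?_ ?_ ?_ ?_ ?_ ?_ ?_
  · have h1 : Measurable fun z : unitInterval × unitInterval =>
        κ * labelSign s (label η (query R x r z.1) z.2) :=
      ((measurable_labelSign s).comp ((measurable_label hηm).comp
        ((hqm.comp measurable_fst).prodMk measurable_snd))).const_mul κ
    have h2 : MeasurableSet {z : unitInterval × unitInterval | query R x r z.1 ∈ J} :=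
      (hqm.comp measurable_fst) hJ
    exact h1.indicator h2
  · intro u v
    by_cases hu : query R x r u ∈ J
    · simp only [indicator_of_mem hu]
      obtain ⟨h1, h2⟩ := labelSign_mem hs (label η (query R x r u) v)
      rcases hκ with rfl | rfl <;> constructor <;> linarith
    · simp only [indicator_of_notMem hu]
      constructor <;> norm_num
  · have h1 : Measurable fun w => κ * (s * (2 * η w - 1)) := by fun_prop
    exact (h1.indicator hJ).comp hqm
  · intro u
    by_cases hu : query R x r u ∈ J
    · simp only [indicator_of_mem hu]
      rw [integral_const_mul, integral_labelSign (hη.prob _ (hsub (hmem u)))]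
    · simp only [indicator_of_notMem hu, integral_zero]
  · intro u
    by_cases hu : query R x r u ∈ J
    · simp only [indicator_of_mem hu]
      refine ⟨hsign _ (hmem u) hu, (le_abs_self _).trans ?_⟩
      rw [habs _ (hsub (hmem u)), abs_le]
      obtain ⟨h0, h1⟩ := hη.prob _ (hsub (hmem u))
      constructor <;> linarith
    · simp only [indicator_of_notMem hu]
      constructor <;> norm_num
  · exact hqm measurableSet_Ioc
  · have h1 : ∀ u : unitInterval, ({u | query R x r u ∈ Ioc p q} : Set unitInterval).indicator
        (fun u => J.indicator (fun w => κ * (s * (2 * η w - 1))) (query R x r u)) u =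
        (Ioc p q).indicator (fun z => |2 * η z - 1|) (query R x r u) := by
      intro u
      by_cases hu : query R x r u ∈ Ioc p q
      · rw [indicator_of_mem hu, indicator_of_mem (show u ∈ {u | query R x r u ∈ Ioc p q} from hu),
          indicator_of_mem (hpqJ hu), ← habs _ (hsub (hmem u)),
          abs_of_nonneg (hsign _ (hmem u) (hpqJ hu))]
      · rw [indicator_of_notMem hu,
          indicator_of_notMem (show u ∉ {u | query R x r u ∈ Ioc p q} from hu)]
    simp_rw [h1]
    rw [integral_comp_query hab, intervalIntegral.integral_of_le hab.le,
      setIntegral_indicator measurableSet_Ioc,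
      inter_eq_self_of_subset_right (Ioc_subset_Ioc hp hq), ← intervalIntegral.integral_of_le hpq]

theorem empiricalRisk_sub_eq_sum {s : ℝ} {N : ℕ} (D : Fin N → ℝ × Bool) {y y' : ℝ} (h : y ≤ y') :
    empiricalRisk s D y' - empiricalRisk s D y =
      ∑ i, if y < (D i).1 ∧ (D i).1 ≤ y' then labelSign s (D i).2 else 0 := by
  unfold empiricalRisk
  rw [← Finset.sum_sub_distrib]
  refine Finset.sum_congr rfl fun i _ => ?_
  by_cases h1 : (D i).1 ≤ y
  · simp [h1, h1.trans h, not_lt.2 h1]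
  · simp [h1, not_le.1 h1]

/-- Empirical risk minimization rarely overshoots the threshold to the right. -/
theorem erm_right_le {s R t x r ε : ℝ} {η : ℝ → ℝ} (hs : s = 1 ∨ s = -1)
    (hη : IsThreshold s R η t) (hab : max 0 (x - r) < min R (x + r)) (hε : 0 ≤ ε) (N : ℕ) :
    volume {z : Fin N → unitInterval × unitInterval |
      clampTo (max 0 (x - r)) (min R (x + r)) t ≤
        ermIcc s (max 0 (x - r)) (min R (x + r)) (sample R η x r z) ∧
      ε < ∫ w in (clampTo (max 0 (x - r)) (min R (x + r)) t)..
        (ermIcc s (max 0 (x - r)) (min R (x + r)) (sample R η x r z)), |2 * η w - 1|} ≤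
      ENNReal.ofReal (Real.exp (-(N * (ε / (min R (x + r) - max 0 (x - r))) ^ 2 / 4))) := by
  have hsub : Icc (max 0 (x - r)) (min R (x + r)) ⊆ Icc 0 R :=
    Icc_subset_Icc (le_max_left _ _) (min_le_left _ _)
  have hmem := query_mem hab.le
  set a := max 0 (x - r) with ha
  set b := min R (x + r) with hb
  set p := clampTo a b t with hpdef
  have hp : p ∈ Icc a b := clampTo_mem hab.le t
  -- The deterministic point `q` replaces the random output: overshooting by more than `ε` forces
  -- the output beyond `q`. If no such `q` exists, the intermediate value theorem shows that the
  -- event is empty.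
  by_cases hex : ∃ q ∈ Icc p b, ∫ w in p..q, |2 * η w - 1| = ε
  · obtain ⟨q, hq, rfl⟩ := hex
    refine le_trans (measure_mono ?_) (measure_overshoot_le (κ := 1) (J := Ioi p) hs (Or.inl rfl)
      hη hab measurableSet_Ioi ?_ hp.1 hq.1 hq.2 (fun z hz => hz.1) N)
    · rintro z ⟨hz1, hz2⟩
      set D := sample R η x r z with hD
      set y := ermIcc s a b D with hy
      have hym : y ∈ Icc a b := ermIcc_mem hab.le D
      have hqy : q ≤ y := by
        by_contra hlt
        rw [not_le] at hlt
        refine absurd hz2 (not_lt.2 ?_)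
        refine intervalIntegral.integral_mono_interval le_rfl hz1 hlt.le
          (ae_of_all _ fun z => abs_nonneg _) ?_
        exact hη.intervalIntegrable (hsub hp) (hsub ⟨hp.1.trans hq.1, hq.2⟩)
      -- This segment also contains the points up to `p`, where the indicator of `J` makes the
      -- summand vanish; what remains is the empirical risk at `y` minus that at `p`.
      refine ⟨Finset.univ.filter fun i => (D i).1 ≤ y, ?_, ?_, ?_⟩
      · intro i hi j hj
        simp only [Finset.mem_filter, Finset.mem_univ, true_and, one_mul] at hi hj ⊢
        exact le_trans hj hi
      · intro i hi
        simp only [Finset.mem_filter, Finset.mem_univ, true_and]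
        exact le_trans hi.2 hqy
      · have h1 := ermIcc_le (s := s) hab.le (D := D) (fun i => hmem _) hp.1
        have h2 := empiricalRisk_sub_eq_sum (s := s) D hz1
        rw [Finset.sum_filter]
        refine le_trans (le_of_eq ?_) (h2 ▸ sub_nonpos.2 h1)
        refine Finset.sum_congr rfl fun i _ => ?_
        change (if (D i).1 ≤ y then (Ioi p).indicator _ (D i).1 else 0) = _
        simp only [indicator, mem_Ioi, one_mul]
        by_cases h3 : (D i).1 ≤ y <;> by_cases h4 : p < (D i).1 <;> (simp [h3, h4]; try rfl)
    · intro z hz hzp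
      have hzt : t < z := by
        by_contra h
        refine absurd (mem_Ioi.1 hzp) (not_lt.2 ?_)
        exact (le_min hz.2 (not_lt.1 h)).trans (le_max_right _ _)
      have := hη.right z (hsub hz) hzt
      linarith
  · rw [show {z : Fin N → unitInterval × unitInterval | _} = (∅ : Set _) from ?_]
    · simp
    · refine eq_empty_of_forall_notMem fun z hz => hex ?_
      obtain ⟨hz1, hz2⟩ := hz
      set y := ermIcc s a b (sample R η x r z) with hy
      have hym : y ∈ Icc a b := ermIcc_mem hab.le _
      have hcont : ContinuousOn (fun w => ∫ z in p..w, |2 * η z - 1|) (Icc p y) := by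
        have := intervalIntegral.continuousOn_primitive_interval (a := p) (b := y)
          (f := fun z => |2 * η z - 1|) (μ := volume)
          (by rw [uIcc_of_le hz1]
              exact hη.integrableOn.mono_set ((Icc_subset_Icc hp.1 hym.2).trans hsub))
        rwa [uIcc_of_le hz1] at this
      obtain ⟨q, hq, hqe⟩ := intermediate_value_Icc hz1 hcont
        (show ε ∈ Icc _ _ from ⟨by simpa using hε, hz2.le⟩)
      exact ⟨q, ⟨hq.1, hq.2.trans hym.2⟩, hqe⟩

/-- Empirical risk minimization rarely overshoots the threshold to the left. -/
theorem erm_left_le {s R t x r ε : ℝ} {η : ℝ → ℝ} (hs : s = 1 ∨ s = -1)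
    (hη : IsThreshold s R η t) (hab : max 0 (x - r) < min R (x + r)) (hε : 0 ≤ ε) (N : ℕ) :
    volume {z : Fin N → unitInterval × unitInterval |
      ermIcc s (max 0 (x - r)) (min R (x + r)) (sample R η x r z) ≤
        clampTo (max 0 (x - r)) (min R (x + r)) t ∧
      ε < ∫ w in (ermIcc s (max 0 (x - r)) (min R (x + r)) (sample R η x r z))..
        (clampTo (max 0 (x - r)) (min R (x + r)) t), |2 * η w - 1|} ≤
      ENNReal.ofReal (Real.exp (-(N * (ε / (min R (x + r) - max 0 (x - r))) ^ 2 / 4))) := by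
  have hsub : Icc (max 0 (x - r)) (min R (x + r)) ⊆ Icc 0 R :=
    Icc_subset_Icc (le_max_left _ _) (min_le_left _ _)
  have hmem := query_mem hab.le
  set a := max 0 (x - r) with ha
  set b := min R (x + r) with hb
  set p := clampTo a b t with hpdef
  have hp : p ∈ Icc a b := clampTo_mem hab.le t
  -- `a < p` excludes a threshold left of the region, where `p = a` exceeds `t` and the labels at
  -- `p` would have the wrong sign.
  by_cases hex : a < p ∧ ∃ q ∈ Icc a p, ∫ w in q..p, |2 * η w - 1| = ε
  · obtain ⟨hap, q, hq, rfl⟩ := hex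
    refine le_trans (measure_mono ?_) (measure_overshoot_le (κ := -1) (J := Iic p) hs (Or.inr rfl)
      hη hab measurableSet_Iic ?_ hq.1 hq.2 hp.2 (fun z hz => hz.2) N)
    · rintro z ⟨hz1, hz2⟩
      set D := sample R η x r z with hD
      set y := ermIcc s a b D with hy
      have hym : y ∈ Icc a b := ermIcc_mem hab.le D
      have hqy : y ≤ q := by
        by_contra hlt
        rw [not_le] at hlt
        refine absurd hz2 (not_lt.2 ?_)
        refine intervalIntegral.integral_mono_interval hlt.le hz1 le_rfl
          (ae_of_all _ fun z => abs_nonneg _) ?_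
        exact hη.intervalIntegrable (hsub ⟨hq.1, hq.2.trans hp.2⟩) (hsub hp)
      refine ⟨Finset.univ.filter fun i => y < (D i).1, ?_, ?_, ?_⟩
      · intro i hi j hj
        simp only [Finset.mem_filter, Finset.mem_univ, true_and] at hi ⊢
        have hj' : (D i).1 ≤ (D j).1 := by
          change query R x r (z i).1 ≤ query R x r (z j).1
          linarith
        exact lt_of_lt_of_le hi hj'
      · intro i hi
        simp only [Finset.mem_filter, Finset.mem_univ, true_and]
        exact lt_of_le_of_lt hqy hi.1
      · have h1 := ermIcc_le (s := s) hab.le (D := D) (fun i => hmem _) hp.1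
        have h2 := empiricalRisk_sub_eq_sum (s := s) D hz1
        rw [Finset.sum_filter]
        refine le_trans (le_of_eq ?_) (neg_nonpos.2 (h2 ▸ sub_nonneg.2 h1))
        rw [← Finset.sum_neg_distrib]
        refine Finset.sum_congr rfl fun i _ => ?_
        change (if y < (D i).1 then (Iic p).indicator _ (D i).1 else 0) = _
        simp only [indicator, mem_Iic]
        by_cases h3 : y < (D i).1 <;> by_cases h4 : (D i).1 ≤ p <;> (simp [h3, h4]; try rfl)
    · intro z hz hzp
      have hpt : p ≤ t := by
        have : p = min b t := max_eq_right (le_of_not_ge fun h => hap.ne' (max_eq_left h))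
        rw [this]; exact min_le_right _ _
      rcases (le_trans hzp hpt).eq_or_lt with h | h
      · rw [h, hη.half]; norm_num
      · have := hη.left z (hsub hz) h
        linarith
  · rw [show {z : Fin N → unitInterval × unitInterval | _} = (∅ : Set _) from ?_]
    · simp
    · refine eq_empty_of_forall_notMem fun z hz => hex ?_
      obtain ⟨hz1, hz2⟩ := hz
      set y := ermIcc s a b (sample R η x r z) with hy
      have hym : y ∈ Icc a b := ermIcc_mem hab.le _
      have hyp : y < p := by
        refine lt_of_le_of_ne hz1 fun h => ?_
        rw [h, intervalIntegral.integral_same] at hz2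
        linarith
      refine ⟨hym.1.trans_lt hyp, ?_⟩
      have hcont : ContinuousOn (fun w => ∫ z in w..p, |2 * η z - 1|) (Icc y p) := by
        have := intervalIntegral.continuousOn_primitive_interval_left (a := y) (b := p)
          (f := fun z => |2 * η z - 1|) (μ := volume)
          (by rw [uIcc_of_le hz1]
              exact hη.integrableOn.mono_set ((Icc_subset_Icc hym.1 hp.2).trans hsub))
        rwa [uIcc_of_le hz1] at this
      obtain ⟨q, hq, hqe⟩ := intermediate_value_Icc' hz1 hcont
        (show ε ∈ Icc _ _ from ⟨by simpa using hε, hz2.le⟩)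
      exact ⟨q, ⟨hym.1.trans hq.1, hq.2⟩, hqe⟩

/-! ### Optimality of empirical risk minimization. -/

/-- The confidence factor of empirical risk minimization. -/
noncomputable def ermFactor (δ : ℝ) : ℝ := 4 * √(Real.log (2 / δ))

theorem isConfidenceFactor_ermFactor : IsConfidenceFactor ermFactor := by
  constructor
  · rintro δ ⟨h0, h1⟩
    have h2 : 2 ≤ 2 / δ := by rw [le_div_iff₀ h0]; linarith
    have h3 := Real.log_le_log two_pos h2
    have h4 := Real.log_two_gt_d9
    unfold ermFactor
    rw [Real.sqrt_lt' (by have := Real.sqrt_pos.2 (by linarith : 0 < Real.log (2 / δ)); linarith),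
      mul_pow, Real.sq_sqrt (by linarith)]
    linarith
  · refine Asymptotics.IsBigO.of_bound 8 ?_
    have hmem : Ioo (0 : ℝ) (1 / 2) ∈ nhdsWithin 0 (Ioi 0) := Ioo_mem_nhdsGT (by norm_num)
    filter_upwards [hmem] with δ hδ
    obtain ⟨h0, h1⟩ := hδ
    unfold ermFactor
    rw [Real.norm_of_nonneg (by positivity), Real.norm_of_nonneg (by positivity)]
    have h2 : Real.log (2 / δ) ≤ 2 ^ 2 * Real.log (1 / δ) := by
      have h3 : 2 ≤ 1 / δ := by rw [le_div_iff₀ h0]; linarith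
      have h4 := Real.log_le_log two_pos h3
      have h5 : 0 < Real.log 2 := Real.log_pos one_lt_two
      have h6 : Real.log (2 / δ) = Real.log 2 + Real.log (1 / δ) := by
        rw [← Real.log_mul (by norm_num) (by positivity)]; congr 1; ring
      linarith
    have h7 := Real.sqrt_le_sqrt h2
    rw [Real.sqrt_mul (by norm_num), Real.sqrt_sq zero_le_two] at h7
    linarith

/-- Empirical risk minimization is an optimal passive learning procedure. -/
theorem isOptimalPassive_erm {s R : ℝ} (hR : 0 < R) (hs : s = 1 ∨ s = -1) :
    IsOptimalPassive s R ermFactor (erm s R) where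
  measurable r N := measurable_erm s R r N
  mem_region x hx r hr N D w := by
    rw [region_eq_Icc]
    exact ermIcc_mem (region_bounds hR hx hr).1.le D
  risk_le η t hη x hx r hr N hN δ hδ y hy := by
    obtain ⟨hab, hL⟩ := region_bounds hR hx hr
    have hsub : Icc (max 0 (x - r)) (min R (x + r)) ⊆ Icc 0 R :=
      Icc_subset_Icc (le_max_left _ _) (min_le_left _ _)
    rw [region_eq_Icc] at hy
    have hN0 : (0 : ℝ) < N := by exact_mod_cast hN
    have hfac : 0 ≤ ermFactor δ := by unfold ermFactor; positivity
    set ε := ermFactor δ * r / √N with hε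
    have hε0 : 0 ≤ ε := by positivity
    have hright := erm_right_le hs hη hab hε0 N
    have hleft := erm_left_le hs hη hab hε0 N
    have hexp : Real.exp (-(N * (ε / (min R (x + r) - max 0 (x - r))) ^ 2 / 4)) ≤ δ / 2 := by
      set L := min R (x + r) - max 0 (x - r) with hLdef
      have hL0 : 0 < L := sub_pos.2 hab
      have hlog : 0 ≤ Real.log (2 / δ) :=
        Real.log_nonneg (by rw [le_div_iff₀ hδ.1]; linarith [hδ.2])
      -- The `4` in `ermFactor` comes from here: it offsets the `1 / 4` in the exponent and `L ≤ 2
      -- r`, leaving failure probability `δ / 2` for each side.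
      have h1 : N * (ε / L) ^ 2 / 4 = Real.log (2 / δ) * (2 * r / L) ^ 2 := by
        rw [hε, ermFactor, div_pow, div_pow, mul_pow, mul_pow, Real.sq_sqrt hlog,
          Real.sq_sqrt hN0.le]
        field_simp
        ring
      have h2 : 1 ≤ (2 * r / L) ^ 2 := one_le_pow₀ (by rw [le_div_iff₀ hL0]; linarith)
      have h3 : Real.log (2 / δ) ≤ N * (ε / L) ^ 2 / 4 := by
        rw [h1]; exact le_mul_of_one_le_right hlog h2
      calc _ ≤ Real.exp (-Real.log (2 / δ)) := Real.exp_le_exp.2 (neg_le_neg h3)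
        _ = δ / 2 := by
          rw [Real.exp_neg, Real.exp_log (div_pos two_pos hδ.1), inv_div]
    set a := max 0 (x - r) with ha
    set b := min R (x + r) with hb
    set p := clampTo a b t with hpdef
    set A₁ := {z : Fin N → unitInterval × unitInterval |
      p ≤ ermIcc s a b (sample R η x r z) ∧
      ε < ∫ w in p..(ermIcc s a b (sample R η x r z)), |2 * η w - 1|} with hA₁
    set A₂ := {z : Fin N → unitInterval × unitInterval |
      ermIcc s a b (sample R η x r z) ≤ p ∧
      ε < ∫ w in (ermIcc s a b (sample R η x r z))..p, |2 * η w - 1|} with hA₂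
    set good := {z : Seed N | excessRisk η t ((erm s R).call R η x r z) - excessRisk η t y ≤ ε}
      with hgood
    -- Covering the whole space bounds the measure of `good` from below by subadditivity alone, so
    -- its measurability is not needed.
    have hcover : (univ : Set (Seed N)) ⊆ good ∪ (A₁ ∪ A₂) ×ˢ univ := by
      intro z _
      by_contra hz
      rw [mem_union, not_or] at hz
      obtain ⟨hz1, hz2⟩ := hz
      refine hz1 ((clampTo_region_excessRisk hη hsub (ermIcc_mem hab.le _) hy).trans ?_)
      have hz3 : z.1 ∉ A₁ ∪ A₂ := fun h => hz2 ⟨h, mem_univ _⟩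
      rw [mem_union, not_or] at hz3
      by_contra hlt
      rw [not_le] at hlt
      rcases le_total p (ermIcc s a b (sample R η x r z.1)) with h | h
      · rw [abs_of_nonneg (intervalIntegral.integral_nonneg h fun _ _ => abs_nonneg _)] at hlt
        exact hz3.1 ⟨h, hlt⟩
      · rw [intervalIntegral.integral_symm, abs_neg,
          abs_of_nonneg (intervalIntegral.integral_nonneg h fun _ _ => abs_nonneg _)] at hlt
        exact hz3.2 ⟨h, hlt⟩
    have hbad : (volume : Measure (Seed N)) ((A₁ ∪ A₂) ×ˢ univ) ≤ ENNReal.ofReal δ := by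
      change ((volume : Measure (Fin N → unitInterval × unitInterval)).prod volume) _ ≤ _
      rw [Measure.prod_prod, measure_univ, mul_one]
      refine (measure_union_le _ _).trans ((add_le_add hright hleft).trans ?_)
      rw [← ENNReal.ofReal_add (Real.exp_nonneg _) (Real.exp_nonneg _)]
      exact ENNReal.ofReal_le_ofReal (by linarith)
    rw [ENNReal.ofReal_sub _ hδ.1.le, ENNReal.ofReal_one, tsub_le_iff_right]
    calc (1 : ENNReal) = volume (univ : Set (Seed N)) := measure_univ.symm
      _ ≤ volume good + volume ((A₁ ∪ A₂) ×ˢ univ) :=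
        (measure_mono hcover).trans (measure_union_le _ _)
      _ ≤ _ := by gcongr

end ActiveThreshold

open ActiveThreshold in
theorem theorem1 (R : ℝ) (hR : 0 < R) (s : ℝ) (hs : s = 1 ∨ s = -1) :
    -- optimal passive procedures exist
    (∃ (C : ℝ → ℝ) (P : PassiveProcedure), IsConfidenceFactor C ∧ IsOptimalPassive s R C P) ∧
    -- with any of them as the black box, the adaptive learner attains the rate
    ∀ C : ℝ → ℝ, IsConfidenceFactor C →
    ∀ k μ M ε₀ δ : ℝ, 2 ≤ k → 0 < μ → μ < M → 0 < ε₀ → 0 < δ → δ < 1 →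
    ∃ (K : ℝ) (p T₀ : ℕ), ∀ T : ℕ, T₀ ≤ T →
      1 ≤ numEpochs C T δ ∧ 1 ≤ epochQueries C T δ ∧
      numEpochs C T δ * epochQueries C T δ ≤ T ∧
      ∀ P : PassiveProcedure, IsOptimalPassive s R C P →
      ∀ (η : ℝ → ℝ) (t : ℝ), IsThreshold s R η t → TNC R η t k μ M ε₀ →
      ∀ x₀ ∈ Set.Icc 0 R,
        ENNReal.ofReal (1 - δ) ≤
          MeasureTheory.volume {ω : Fin (numEpochs C T δ) → Seed (epochQueries C T δ) |
            excessRisk η t (adaptiveLearner R η C P T δ x₀ ω) ≤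
              K * Real.logb 2 T ^ p * (T : ℝ) ^ (-(k / (2 * k - 2)))} :=
  ⟨⟨ermFactor, erm s R, isConfidenceFactor_ermFactor, isOptimalPassive_erm hR hs⟩,
    fun _ hC _ _ _ _ _ hk hμ _ hε hδ0 hδ1 => adaptiveLearner_rate hR s hC hk hμ hε hδ0 hδ1⟩
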